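/- Let $\mathbb{K}$ be an algebraically closed field of characteristic zero. An affine algebraic monoid is an irreducible affine variety $X$ over $\mathbb{K}$ with an associative multiplication $\mu\colon X\times X\to X$, $(x,y)\mapsto x*y$, that is a morphism and has a unity; its group $X_0$ of invertible elements is an algebraic group, open in $X$. An isomorphism of monoids is a multiplicative isomorphism of varieties. Suppose that $X_0 = T \rightthreetimes U$ is a semidirect product of algebraic groups, where $T, U\subseteq X_0$ are closed commutative subgroups and $U$ is normal. The left commutative reduction ${}^c\!\mu$ of $\mu$ with respect to $T, U$ is the unique morphism $X\times X\to X$ that extends the maps $$X_0\times X\to X,\ (t*u,\,x)\mapsto t*x*u \quad\text{and}\quad X\times X_0\to X,\ (x,\,t*u)\mapsto t*x*u \qquad (t\in T,\ u\in U),$$ and the right commutative reduction $\mu^c$ is the unique morphism $X\times X\to X$ that extends the maps $$X_0\times X\to X,\ (v*t,\,x)\mapsto v*x*t \quad\text{and}\quad X\times X_0\to X,\ (x,\,v*t)\mapsto v*x*t \qquad (t\in T,\ v\in U).$$ Both morphisms exist and are commutative monoid structures on $X$. **Corollary 3.7.** Let $(X,\mu)$ and $(\widetilde X,\widetilde\mu)$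 be isomorphic affine algebraic monoids whose groups of invertible elements are isomorphic to a semidirect product of a torus and a commutative unipotent group. Write $X_0 = T\rightthreetimes U$ and $\widetilde X_0=\widetilde T\rightthreetimes\widetilde U$ with $T,\widetilde T$ tori and $U,\widetilde U$ commutative unipotent groups, these decompositions being chosen arbitrarily and independently of each other, and form the commutative reductions with respect to them. Then (a) the monoids $(X,{}^c\!\mu)$ and $(\widetilde X,{}^c\widetilde\mu)$ are isomorphic; (b) the monoids $(X,\mu^c)$ and $(\widetilde X,\widetilde\mu^c)$ are isomorphic. -/

import Mathlib

/-! ### Affine varieties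

Classical affine varieties over an algebraically closed field, presented as a set of points
together with the algebra of regular functions on it. -/

/-- An affine variety over `K` (meant for algebraically closed `K`): a set `X` with a finitely
generated algebra `K[X]` of `K`-valued functions such that evaluation identifies the points of `X`
with the `K`-algebra homomorphisms `K[X] → K`. By the Nullstellensatz these are, up to isomorphism,
exactly the Zariski closed subsets of affine spaces with their polynomial functions. -/
class AffineVariety (K : Type*) [Field K] (X : Type*) where
  /-- the algebra `K[X]` of regular functions -/
  functions : Subalgebra K (X → K)
  fg_functions : functions.FG
  bijective_eval : Function.Bijective
    (fun x : X => ((Pi.evalAlgHom K (fun _ : X => K) x).comp functions.val : functions →ₐ[K] K))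

namespace AffineVariety

/-- The coordinate ring `K[X]`, an algebra of functions on `X`. -/
abbrev coordRing (K : Type*) [Field K] (X : Type*) [AffineVariety K X] : Subalgebra K (X → K) :=
  functions

section

variable {K : Type*} [Field K]

theorem point_ext {X : Type*} [AffineVariety K X] {x y : X}
    (h : ∀ f ∈ coordRing K X, f x = f y) : x = y := by
  apply (bijective_eval (K := K) (X := X)).1
  ext f
  exact h f.1 f.2

theorem exists_point {X : Type*} [AffineVariety K X] (φ : coordRing K X →ₐ[K] K) :
    ∃ x : X, ∀ f : coordRing K X, φ f = f.1 x := by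
  obtain ⟨x, hx⟩ := (bijective_eval (K := K) (X := X)).2 φ
  exact ⟨x, fun f => by rw [← hx]; rfl⟩

theorem bijective_eval_adjoin {X ι : Type*} (c : ι → X → K)
    (hc : Function.Bijective (fun (x : X) (i : ι) => c i x)) :
    Function.Bijective (fun x : X => ((Pi.evalAlgHom K (fun _ : X => K) x).comp
      (Algebra.adjoin K (Set.range c)).val : Algebra.adjoin K (Set.range c) →ₐ[K] K)) := by
  constructor
  · intro x y h
    apply hc.1
    funext i
    exact DFunLike.congr_fun h ⟨c i, Algebra.subset_adjoin ⟨i, rfl⟩⟩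
  · intro φ
    obtain ⟨x, hx⟩ := hc.2 (fun i => φ ⟨c i, Algebra.subset_adjoin ⟨i, rfl⟩⟩)
    refine ⟨x, ?_⟩
    apply AlgHom.ext_of_eq_adjoin rfl
    rintro _ ⟨i, rfl⟩
    exact congrFun hx i

theorem fg_adjoin_range {A ι : Type*} [Finite ι] [CommRing A] [Algebra K A] (c : ι → A) :
    (Algebra.adjoin K (Set.range c)).FG :=
  Subalgebra.fg_def.2 ⟨_, Set.finite_range c, rfl⟩

/-- Affine space `𝔸^ι` with the polynomial functions. -/
instance instPi (ι : Type*) [Finite ι] : AffineVariety K (ι → K) where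
  functions := Algebra.adjoin K (Set.range (fun (i : ι) (x : ι → K) => x i))
  fg_functions := fg_adjoin_range _
  bijective_eval := bijective_eval_adjoin _ Function.bijective_id

/-- The affine space of matrices with the functions that are polynomial in the entries. -/
instance instMatrix (m n : Type*) [Finite m] [Finite n] : AffineVariety K (Matrix m n K) where
  functions := Algebra.adjoin K (Set.range (fun (p : m × n) (M : Matrix m n K) => M p.1 p.2))
  fg_functions := fg_adjoin_range _
  bijective_eval := bijective_eval_adjoin _
    ⟨fun M N h => by ext i j; exact congrFun h (i, j), fun c => ⟨fun i j => c (i, j), rfl⟩⟩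

/-- The pullback of functions along a map. -/
def pullback (K : Type*) [Field K] {Z X : Type*} (φ : Z → X) : (X → K) →ₐ[K] (Z → K) :=
  AlgHom.pi (fun z => Pi.evalAlgHom K (fun _ : X => K) (φ z))

theorem pullback_apply {Z X : Type*} (φ : Z → X) (f : X → K) (z : Z) :
    pullback K φ f z = f (φ z) := rfl

/-- The product of affine varieties: `K[X × Y]` is generated by the functions `(x, y) ↦ a x` and
`(x, y) ↦ b y` with `a ∈ K[X]` and `b ∈ K[Y]`, so that `K[X × Y] = K[X] ⊗ K[Y]`. -/
instance instProd (X Y : Type*) [AffineVariety K X] [AffineVariety K Y] :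
    AffineVariety K (X × Y) where
  functions := (coordRing K X).map (pullback K Prod.fst) ⊔ (coordRing K Y).map (pullback K Prod.snd)
  fg_functions := (fg_functions.map _).sup (fg_functions.map _)
  bijective_eval := by
    have hX : ∀ f ∈ coordRing K X, pullback K (Prod.fst : X × Y → X) f ∈
        (coordRing K X).map (pullback K Prod.fst) ⊔
          (coordRing K Y).map (pullback K (Prod.snd : X × Y → Y)) :=
      fun f hf => (le_sup_left : (coordRing K X).map (pullback K Prod.fst) ≤ _) ⟨f, hf, rfl⟩
    have hY : ∀ f ∈ coordRing K Y, pullback K (Prod.snd : X × Y → Y) f ∈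
        (coordRing K X).map (pullback K Prod.fst) ⊔
          (coordRing K Y).map (pullback K (Prod.snd : X × Y → Y)) :=
      fun f hf => (le_sup_right : (coordRing K Y).map (pullback K Prod.snd) ≤ _) ⟨f, hf, rfl⟩
    constructor
    · rintro ⟨x, y⟩ ⟨x', y'⟩ h
      refine Prod.ext (point_ext (K := K) fun f hf => ?_) (point_ext (K := K) fun f hf => ?_)
      · exact DFunLike.congr_fun h ⟨_, hX f hf⟩
      · exact DFunLike.congr_fun h ⟨_, hY f hf⟩
    · intro φ
      obtain ⟨x, hx⟩ := exists_point (X := X) (φ.comp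
        (((pullback K Prod.fst).comp (coordRing K X).val).codRestrict _ fun f => hX f.1 f.2))
      obtain ⟨y, hy⟩ := exists_point (X := Y) (φ.comp
        (((pullback K Prod.snd).comp (coordRing K Y).val).codRestrict _ fun f => hY f.1 f.2))
      refine ⟨(x, y), ?_⟩
      apply AlgHom.ext_of_eq_adjoin (Algebra.sup_def _ _)
      rintro _ (⟨f, hf, rfl⟩ | ⟨f, hf, rfl⟩)
      · exact (hx ⟨f, hf⟩).symm
      · exact (hy ⟨f, hf⟩).symm

/-- A map of affine varieties is a morphism if it pulls regular functions back to regular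
functions. -/
def IsMorphism (K : Type*) [Field K] {X Y : Type*} [AffineVariety K X] [AffineVariety K Y]
    (φ : X → Y) : Prop :=
  ∀ f ∈ coordRing K Y, pullback K φ f ∈ coordRing K X

/-- Let `Z` be identified, through the injective map `i`, with a locally closed subset of the affine
variety `X`. A function on `Z` is regular if locally, in the Zariski topology, it is a quotient of
two functions from `K[X]`. -/
def IsRegularOn (K : Type*) [Field K] {Z X : Type*} [AffineVariety K X] (i : Z → X)
    (h : Z → K) : Prop :=
  ∀ z : Z, ∃ f ∈ coordRing K X, ∃ g ∈ coordRing K X, g (i z) ≠ 0 ∧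
    ∀ w : Z, g (i w) ≠ 0 → h w = f (i w) / g (i w)

end

end AffineVariety

open AffineVariety

/-! ### Algebraic monoids and their groups of invertible elements -/

/-- An affine algebraic monoid: an affine variety with an associative and unital multiplication
that is a morphism of varieties. -/
class IsAlgebraicMonoid (K : Type*) [Field K] (X : Type*) [AffineVariety K X] [Monoid X] :
    Prop where
  isMorphism_mul : IsMorphism K (fun p : X × X => p.1 * p.2)

/-- An isomorphism of algebraic monoids: an isomorphism of varieties that is multiplicative. -/
structure AlgebraicMonoidIso (K : Type*) [Field K] (X Y : Type*) [AffineVariety K X]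
    [AffineVariety K Y] [Monoid X] [Monoid Y] extends X ≃* Y where
  isMorphism_toFun : IsMorphism K toMulEquiv
  isMorphism_invFun : IsMorphism K toMulEquiv.symm

section

/-- A subgroup of the group `Xˣ` of invertible elements is closed (in `Xˣ`, in the Zariski
topology) if it is cut out in `Xˣ` by regular functions on `X`. -/
def IsClosedSubgroup (K : Type*) [Field K] {X : Type*} [AffineVariety K X] [Monoid X]
    (H : Subgroup Xˣ) : Prop :=
  ∃ S ⊆ (coordRing K X : Set (X → K)), ∀ g : Xˣ, g ∈ H ↔ ∀ f ∈ S, f (g : X) = 0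

/-- The inclusion into `X` of a subgroup of the group of invertible elements of `X`. -/
def subgroupInclusion {X : Type*} [Monoid X] (H : Subgroup Xˣ) (h : H) : X := ((h : Xˣ) : X)

/-- An isomorphism of algebraic groups between closed subgroups of the groups of invertible elements
of two algebraic monoids: an isomorphism of groups that is regular in both directions. -/
structure AlgebraicGroupIso (K : Type*) [Field K] {X Y : Type*} [AffineVariety K X]
    [AffineVariety K Y] [Monoid X] [Monoid Y] (H : Subgroup Xˣ) (H' : Subgroup Yˣ)
    extends H ≃* H' where
  isRegular_toFun : ∀ f ∈ coordRing K Y,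
    IsRegularOn K (subgroupInclusion H) (fun h => f (subgroupInclusion H' (toMulEquiv h)))
  isRegular_invFun : ∀ f ∈ coordRing K X,
    IsRegularOn K (subgroupInclusion H') (fun h => f (subgroupInclusion H (toMulEquiv.symm h)))

/-- A torus: a closed subgroup isomorphic, as an algebraic group, to `𝔾ₘᵖ` for some `p ≥ 0`, the
group of invertible elements of `Kᵖ` with the coordinatewise multiplication. -/
def IsTorus (K : Type*) [Field K] {X : Type*} [AffineVariety K X] [Monoid X]
    (H : Subgroup Xˣ) : Prop :=
  IsClosedSubgroup K H ∧
    ∃ p : ℕ, Nonempty (AlgebraicGroupIso K H (⊤ : Subgroup (Fin p → K)ˣ))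

/-- A unipotent group: a closed subgroup isomorphic, as an algebraic group, to a closed subgroup of
`GLₙ(K)` that consists of unipotent matrices. -/
def IsUnipotentGroup (K : Type*) [Field K] {X : Type*} [AffineVariety K X] [Monoid X]
    (H : Subgroup Xˣ) : Prop :=
  IsClosedSubgroup K H ∧
    ∃ (n : ℕ) (H' : Subgroup (Matrix (Fin n) (Fin n) K)ˣ), IsClosedSubgroup K H' ∧
      (∀ M ∈ H', IsNilpotent ((M : Matrix (Fin n) (Fin n) K) - 1)) ∧
      Nonempty (AlgebraicGroupIso K H H')

/-- Subgroups `T` and `U` of the group `Xˣ` of invertible elements of the algebraic monoid `X` that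
exhibit it as a semidirect product `T ⋉ U` of commutative linear algebraic groups: they are closed
and commutative, `U` is normal, and `T × U → Xˣ`, `(t, u) ↦ t * u`, is an isomorphism of varieties,
that is, every `g` is uniquely `t * u`, and `t` and `u` depend regularly on `g`. -/
structure SemidirectDecomposition (K : Type*) [Field K] (X : Type*) [AffineVariety K X]
    [Monoid X] where
  T : Subgroup Xˣ
  U : Subgroup Xˣ
  isClosed_T : IsClosedSubgroup K T
  isClosed_U : IsClosedSubgroup K U
  comm_T : ∀ t ∈ T, ∀ t' ∈ T, t * t' = t' * t
  comm_U : ∀ u ∈ U, ∀ u' ∈ U, u * u' = u' * u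
  normal_U : U.Normal
  isComplement : Subgroup.IsComplement' T U
  isRegular_fst : ∀ f ∈ coordRing K X,
    IsRegularOn K (Units.val : Xˣ → X) (fun g => f ((isComplement.equiv g).1 : Xˣ))
  isRegular_snd : ∀ f ∈ coordRing K X,
    IsRegularOn K (Units.val : Xˣ → X) (fun g => f ((isComplement.equiv g).2 : Xˣ))

end

/-! ### Commutative reductions -/

namespace CommutativeReduction

section

variable {K : Type*} [Field K]

/-- The linear functionals on a finite-dimensional space of functions are linear combinations of
evaluations at the points of any set on which no non-zero function of that space vanishes. -/
theorem span_eval_eq_top {X : Type*} (W : Submodule K (X → K)) [FiniteDimensional K W]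
    (S : Set X) (hS : ∀ w ∈ W, (∀ s ∈ S, w s = 0) → w = 0) :
    Submodule.span K ((fun s : X =>
      ((LinearMap.proj s : (X → K) →ₗ[K] K).comp W.subtype : W →ₗ[K] K)) '' S) = ⊤ := by
  apply Submodule.span_eq_top_of_ne_zero
  intro w hw
  by_contra! h
  apply hw
  apply Subtype.ext
  exact hS w.1 w.2 fun s hs => h _ ⟨s, hs, rfl⟩

theorem exists_regular_of_functional {X Z G : Type*} [AffineVariety K Z]
    (W : Submodule K (X → K)) [FiniteDimensional K W] (S : Set X)
    (hS : ∀ w ∈ W, (∀ s ∈ S, w s = 0) → w = 0) (i : G → Z) (F : G → W)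
    (hF : ∀ s ∈ S, ∃ b ∈ coordRing K Z, ∀ g, b (i g) = (F g).1 s) (l : W →ₗ[K] K) :
    ∃ b ∈ coordRing K Z, ∀ g, b (i g) = l (F g) := by
  have hl : l ∈ Submodule.span K ((fun s : X =>
      ((LinearMap.proj s : (X → K) →ₗ[K] K).comp W.subtype : W →ₗ[K] K)) '' S) := by
    rw [span_eval_eq_top W S hS]; trivial
  induction hl using Submodule.span_induction with
  | mem l hl =>
    obtain ⟨s, hs, rfl⟩ := hl
    exact hF s hs
  | zero => exact ⟨0, zero_mem _, fun g => rfl⟩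
  | add l l' _ _ h h' =>
    obtain ⟨b, hb, h⟩ := h
    obtain ⟨b', hb', h'⟩ := h'
    exact ⟨b + b', add_mem hb hb', fun g => by simp [h, h']⟩
  | smul c l _ h =>
    obtain ⟨b, hb, h⟩ := h
    exact ⟨c • b, Subalgebra.smul_mem _ hb c, fun g => by simp [h]⟩

theorem isMorphism_fst {X Y : Type*} [AffineVariety K X] [AffineVariety K Y] :
    IsMorphism K (Prod.fst : X × Y → X) := fun f hf =>
  (le_sup_left : (coordRing K X).map (pullback K Prod.fst) ≤ coordRing K (X × Y)) ⟨f, hf, rfl⟩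

theorem isMorphism_snd {X Y : Type*} [AffineVariety K X] [AffineVariety K Y] :
    IsMorphism K (Prod.snd : X × Y → Y) := fun f hf =>
  (le_sup_right : (coordRing K Y).map (pullback K Prod.snd) ≤ coordRing K (X × Y)) ⟨f, hf, rfl⟩

theorem isMorphism_const {X Y : Type*} [AffineVariety K X] [AffineVariety K Y] (y : Y) :
    IsMorphism K (fun _ : X => y) := fun f _ =>
  (coordRing K X).algebraMap_mem (f y)

theorem isMorphism_id {X : Type*} [AffineVariety K X] : IsMorphism K (fun x : X => x) :=
  fun _ hf => hf

theorem isMorphism_comp {X Y Z : Type*} [AffineVariety K X] [AffineVariety K Y]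
    [AffineVariety K Z] {ψ : Y → Z} {φ : X → Y} (hψ : IsMorphism K ψ) (hφ : IsMorphism K φ) :
    IsMorphism K (fun x => ψ (φ x)) := fun f hf => hφ _ (hψ f hf)

theorem isMorphism_prodMk {X Y Z : Type*} [AffineVariety K X] [AffineVariety K Y]
    [AffineVariety K Z] {φ : Z → X} {ψ : Z → Y} (hφ : IsMorphism K φ) (hψ : IsMorphism K ψ) :
    IsMorphism K (fun z => (φ z, ψ z)) := by
  have : coordRing K (X × Y) ≤ (coordRing K Z).comap (pullback K (fun z => (φ z, ψ z))) := by
    apply sup_le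
    · rintro _ ⟨f, hf, rfl⟩
      exact hφ f hf
    · rintro _ ⟨f, hf, rfl⟩
      exact hψ f hf
  exact this

/-- The functions `F (x, ·)` for `F ∈ K[X × Y]` lie in a finite-dimensional subspace of `K[Y]`. -/
theorem exists_finite_slices {X Y : Type*} [AffineVariety K X] [AffineVariety K Y]
    (F : X × Y → K) (hF : F ∈ coordRing K (X × Y)) :
    ∃ W : Submodule K (Y → K), W.FG ∧ W ≤ Subalgebra.toSubmodule (coordRing K Y) ∧
      ∀ x, (fun y => F (x, y)) ∈ W := by
  have hF' : F ∈ Algebra.adjoin K (((coordRing K X).map (pullback K (Prod.fst : X × Y → X)) : Set (X × Y → K)) ∪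
      ((coordRing K Y).map (pullback K (Prod.snd : X × Y → Y)) : Set (X × Y → K))) := by
    rw [← Algebra.sup_def]; exact hF
  have hone : Submodule.span K {(1 : Y → K)} ≤ Subalgebra.toSubmodule (coordRing K Y) := by
    rw [Submodule.span_singleton_le_iff_mem]; exact (coordRing K Y).one_mem
  clear hF
  induction hF' using Algebra.adjoin_induction with
  | mem F hF =>
    rcases hF with ⟨f, hf, rfl⟩ | ⟨f, hf, rfl⟩
    · refine ⟨Submodule.span K {1}, Submodule.fg_span_singleton _, hone, fun x => ?_⟩
      exact Submodule.mem_span_singleton.2 ⟨f x, by ext; simp [pullback_apply]⟩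
    · refine ⟨Submodule.span K {f}, Submodule.fg_span_singleton _, ?_, fun x => ?_⟩
      · rw [Submodule.span_singleton_le_iff_mem]; exact hf
      · exact Submodule.mem_span_singleton_self f
  | algebraMap c =>
    refine ⟨Submodule.span K {1}, Submodule.fg_span_singleton _, hone, fun x => ?_⟩
    exact Submodule.mem_span_singleton.2 ⟨c, by ext; simp⟩
  | add F G _ _ h h' =>
    obtain ⟨W, h1, h2, h3⟩ := h
    obtain ⟨W', h1', h2', h3'⟩ := h'
    exact ⟨W ⊔ W', h1.sup h1', sup_le h2 h2', fun x =>
      add_mem ((le_sup_left : W ≤ W ⊔ W') (h3 x)) ((le_sup_right : W' ≤ W ⊔ W') (h3' x))⟩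
  | mul F G _ _ h h' =>
    obtain ⟨W, h1, h2, h3⟩ := h
    obtain ⟨W', h1', h2', h3'⟩ := h'
    refine ⟨W * W', h1.mul h1', Submodule.mul_le.2 fun a ha b hb => ?_, fun x =>
      Submodule.mul_mem_mul (h3 x) (h3' x)⟩
    exact (coordRing K Y).mul_mem (h2 ha) (h2' hb)

variable {X : Type*} [AffineVariety K X] [Monoid X] [IsAlgebraicMonoid K X]

theorem isMorphism_mul {Z : Type*} [AffineVariety K Z] {φ ψ : Z → X} (hφ : IsMorphism K φ)
    (hψ : IsMorphism K ψ) : IsMorphism K (fun z => φ z * ψ z) :=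
  isMorphism_comp (IsAlgebraicMonoid.isMorphism_mul (K := K) (X := X)) (isMorphism_prodMk hφ hψ)

/-- The two-sided translates of a regular function span a finite-dimensional space. -/
theorem exists_finite_translates (f : X → K) (hf : f ∈ coordRing K X) :
    ∃ W : Submodule K (X → K), W.FG ∧ W ≤ Subalgebra.toSubmodule (coordRing K X) ∧
      ∀ a b : X, (fun x => f (a * x * b)) ∈ W := by
  have h : IsMorphism K (fun p : (X × X) × X => p.1.1 * p.2 * p.1.2) :=
    isMorphism_mul (isMorphism_mul (isMorphism_comp isMorphism_fst isMorphism_fst) isMorphism_snd)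
      (isMorphism_comp isMorphism_snd isMorphism_fst)
  obtain ⟨W, h1, h2, h3⟩ := exists_finite_slices _ (h f hf)
  exact ⟨W, h1, h2, fun a b => h3 (a, b)⟩

theorem injective_of_surjective_ringHom {R : Type*} [CommRing R] [IsNoetherianRing R] (φ : R →+* R)
    (hφ : Function.Surjective φ) : Function.Injective φ := by
  have hmem : ∀ n x, x ∈ RingHom.ker (φ ^ n) ↔ (φ ^ n) x = 0 := fun n x => RingHom.mem_ker
  obtain ⟨n, hn⟩ := monotone_stabilizes_iff_noetherian.2 ‹IsNoetherianRing R›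
    ⟨fun n => RingHom.ker (φ ^ n), monotone_nat_of_le_succ fun n x hx => by
      rw [hmem] at hx ⊢
      rw [pow_succ', RingHom.mul_def, RingHom.comp_apply, hx, map_zero]⟩
  rw [injective_iff_map_eq_zero]
  intro x hx
  have hsurj : Function.Surjective (φ ^ n) := by
    rw [RingHom.coe_pow]; exact hφ.iterate n
  obtain ⟨y, rfl⟩ := hsurj x
  have hy : y ∈ RingHom.ker (φ ^ (n + 1)) := by
    rw [hmem, pow_succ', RingHom.mul_def, RingHom.comp_apply, hx]
  have := hn (n + 1) (Nat.le_succ n)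
  change RingHom.ker (φ ^ n) = RingHom.ker (φ ^ (n + 1)) at this
  rw [← this] at hy
  exact hy

/-- The group of invertible elements contains a non-empty principal open subset. -/
theorem exists_principal_open : ∃ d ∈ coordRing K X, d 1 ≠ 0 ∧ ∀ x : X, d x ≠ 0 → IsUnit x := by
  obtain ⟨s, hs⟩ := fg_functions (K := K) (X := X)
  have hs' : ∀ f ∈ s, f ∈ coordRing K X := fun f hf => by
    have : f ∈ Algebra.adjoin K (s : Set (X → K)) := Algebra.subset_adjoin hf
    rw [hs] at this; exact this
  choose! W hW1 hW2 hW3 using fun f hf => exists_finite_translates (K := K) f (hs' f hf)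
  set V : Submodule K (X → K) :=
    Submodule.span K {v | ∃ f ∈ s, ∃ b : X, v = fun x => f (x * b)} with hV
  have hVW : V ≤ s.sup W := by
    rw [hV, Submodule.span_le]
    rintro _ ⟨f, hf, b, rfl⟩
    have := hW3 f hf 1 b
    simp only [one_mul] at this
    exact Finset.le_sup (f := W) hf this
  have hWfg : (s.sup W).FG := Submodule.fg_finset_sup s W hW1
  have hVreg : ∀ v ∈ V, v ∈ coordRing K X := fun v hv =>
    (Finset.sup_le hW2 : s.sup W ≤ Subalgebra.toSubmodule (coordRing K X)) (hVW hv)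
  have : FiniteDimensional K (s.sup W : Submodule K (X → K)) := Module.Finite.of_fg hWfg
  have : FiniteDimensional K V := Submodule.finiteDimensional_of_le hVW
  have hstab : ∀ b : X, ∀ v ∈ V, pullback K (fun x => x * b) v ∈ V := by
    intro b v hv
    induction hv using Submodule.span_induction with
    | mem v hv =>
      obtain ⟨f, hf, c, rfl⟩ := hv
      refine Submodule.subset_span ⟨f, hf, b * c, ?_⟩
      ext x
      simp [pullback_apply, mul_assoc]
    | zero => simp
    | add v w _ _ h h' => rw [map_add]; exact add_mem h h'
    | smul c v _ h => rw [map_smul]; exact V.smul_mem c h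
  let R : X → (V →ₗ[K] V) := fun b => (pullback K (fun x : X => x * b)).toLinearMap.restrict (hstab b)
  have hR : ∀ b (v : V) x, (R b v).1 x = v.1 (x * b) := fun b v x => rfl
  let e := Module.finBasis K V
  refine ⟨fun b => LinearMap.det (R b), ?_, ?_, ?_⟩
  · have hentry : ∀ i j, (fun b => LinearMap.toMatrix e e (R b) i j) ∈ coordRing K X := by
      intro i j
      obtain ⟨c, hc, hc'⟩ := exists_regular_of_functional (Z := X) V Set.univ
        (fun w _ h => funext fun x => h x trivial) id (fun b => R b (e j))
        (fun x _ => ⟨fun b => (e j).1 (x * b),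
          isMorphism_mul (isMorphism_const x) isMorphism_id _ (hVreg _ (e j).2), fun b => rfl⟩)
        (e.coord i)
      convert hc using 1
      ext b
      rw [LinearMap.toMatrix_apply]
      exact (hc' b).symm
    have : (fun b => LinearMap.det (R b)) = ∑ σ : Equiv.Perm (Fin (Module.finrank K V)),
        Equiv.Perm.sign σ • ∏ i, (fun b => LinearMap.toMatrix e e (R b) (σ i) i) := by
      ext b
      rw [← LinearMap.det_toMatrix e, Matrix.det_apply]
      simp [Finset.sum_apply, Finset.prod_apply]
    rw [this]
    refine sum_mem fun σ _ => ?_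
    have hp := prod_mem (t := Finset.univ) fun i _ => hentry (σ i) i
    rcases Int.units_eq_one_or (Equiv.Perm.sign σ) with h | h
    · rw [h, one_smul]; exact hp
    · rw [h, Units.neg_smul, one_smul]; exact neg_mem hp
  · have : R 1 = LinearMap.id := by
      ext v x
      simp [hR]
    simp [this]
  · intro b hb
    have hsurj : Function.Surjective (R b) := by
      have := LinearMap.isUnit_iff_isUnit_det (R b) |>.2 (isUnit_iff_ne_zero.2 hb)
      exact ((Module.End.isUnit_iff _).1 this).2
    have hmor : IsMorphism K (fun x : X => x * b) := isMorphism_mul isMorphism_id (isMorphism_const b)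
    let φ : coordRing K X →ₐ[K] coordRing K X :=
      ((pullback K (fun x : X => x * b)).comp (coordRing K X).val).codRestrict _
        fun f => hmor f.1 f.2
    have hφ : Function.Surjective φ := by
      have hle : coordRing K X ≤ φ.range.map (coordRing K X).val := by
        show functions ≤ _
        rw [← hs, Algebra.adjoin_le_iff]
        intro f hf
        have hfV : f ∈ V := Submodule.subset_span ⟨f, hf, 1, by simp⟩
        obtain ⟨v, hv⟩ := hsurj ⟨f, hfV⟩
        refine ⟨φ ⟨v.1, hVreg _ v.2⟩, ⟨_, rfl⟩, ?_⟩
        exact congrArg Subtype.val hv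
      intro f
      obtain ⟨f', ⟨g, hg⟩, hf'⟩ := hle f.2
      exact ⟨g, Subtype.ext ((congrArg Subtype.val hg).trans hf')⟩
    have : IsNoetherianRing (coordRing K X) := by
      have : Algebra.FiniteType K (coordRing K X) :=
        (coordRing K X).fg_iff_finiteType.1 fg_functions
      exact Algebra.FiniteType.isNoetherianRing K _
    have hbij : Function.Bijective φ := ⟨injective_of_surjective_ringHom φ.toRingHom hφ, hφ⟩
    have hinj : ∀ x y : X, x * b = y * b → x = y := by
      intro x y hxy
      apply point_ext (K := K)
      intro f hf
      obtain ⟨g, hg⟩ := hφ ⟨f, hf⟩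
      have hg' : ∀ z, f z = g.1 (z * b) := fun z => (congrFun (congrArg Subtype.val hg) z).symm
      rw [hg', hg', hxy]
    let ψ := AlgEquiv.ofBijective φ hbij
    obtain ⟨y, hy⟩ := exists_point ((((Pi.evalAlgHom K (fun _ : X => K) 1).comp
      (coordRing K X).val : coordRing K X →ₐ[K] K)).comp ψ.symm.toAlgHom)
    have hyb : y * b = 1 := by
      apply point_ext (K := K)
      intro f hf
      have h1 := hy (φ ⟨f, hf⟩)
      have h2 : ψ.symm (φ ⟨f, hf⟩) = ⟨f, hf⟩ := ψ.symm_apply_apply _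
      have h3 : f 1 = f (y * b) := by
        refine Eq.trans ?_ h1
        show f 1 = (ψ.symm (φ ⟨f, hf⟩)).1 1
        rw [h2]
      exact h3.symm
    have hby : b * y = 1 := hinj _ _ (by rw [mul_assoc, hyb, mul_one, one_mul])
    exact ⟨⟨b, y, hby, hyb⟩, rfl⟩

variable [IsDomain (coordRing K X)]

/-- The group of invertible elements of an irreducible affine monoid is dense. -/
theorem eq_of_eqOn_units {f f' : X → K} (hf : f ∈ coordRing K X) (hf' : f' ∈ coordRing K X)
    (h : ∀ g : Xˣ, f g = f' g) : f = f' := by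
  obtain ⟨d, hd, hd1, hd2⟩ := exists_principal_open (K := K) (X := X)
  have hmul : (⟨f, hf⟩ - ⟨f', hf'⟩ : coordRing K X) * ⟨d, hd⟩ = 0 := by
    apply Subtype.ext
    funext x
    show (f x - f' x) * d x = 0
    by_cases hx : d x = 0
    · rw [hx, mul_zero]
    · obtain ⟨g, rfl⟩ := hd2 x hx
      rw [h g, sub_self, zero_mul]
  rcases mul_eq_zero.1 hmul with h0 | h0
  · exact congrArg Subtype.val (sub_eq_zero.1 h0)
  · exact absurd (congrFun (congrArg Subtype.val h0) 1) hd1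

theorem eq_of_eqOn_units_prod {F F' : X × X → K} (hF : F ∈ coordRing K (X × X))
    (hF' : F' ∈ coordRing K (X × X)) (h : ∀ g g' : Xˣ, F (g, g') = F' (g, g')) : F = F' := by
  have hleft : ∀ G ∈ coordRing K (X × X), ∀ y, (fun x => G (x, y)) ∈ coordRing K X :=
    fun G hG y => isMorphism_prodMk isMorphism_id (isMorphism_const y) G hG
  have hright : ∀ G ∈ coordRing K (X × X), ∀ x, (fun y => G (x, y)) ∈ coordRing K X :=
    fun G hG x => isMorphism_prodMk (isMorphism_const x) isMorphism_id G hG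
  have h1 : ∀ (g : Xˣ) y, F (g, y) = F' (g, y) := fun g y =>
    congrFun (eq_of_eqOn_units (hright F hF g) (hright F' hF' g) (h g)) y
  funext ⟨x, y⟩
  exact congrFun (eq_of_eqOn_units (hleft F hF y) (hleft F' hF' y) fun g => h1 g y) x

theorem morphism_eq_of_eqOn_units {Y : Type*} [AffineVariety K Y] {φ ψ : X → Y}
    (hφ : IsMorphism K φ) (hψ : IsMorphism K ψ) (h : ∀ g : Xˣ, φ g = ψ g) : φ = ψ := by
  funext x
  apply point_ext (K := K)
  intro f hf
  exact congrFun (eq_of_eqOn_units (hφ f hf) (hψ f hf) fun g => congrArg f (h g)) x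

theorem exists_mul_decomposition {G : Type*} [Group G] {A B : Subgroup G}
    (hAB : Subgroup.IsComplement' A B) (g : G) : ∃ a ∈ A, ∃ b ∈ B, g = a * b :=
  ⟨_, (hAB.equiv g).1.2, _, (hAB.equiv g).2.2, (hAB.equiv_fst_mul_equiv_snd g).symm⟩

theorem mul_decomposition_inj {G : Type*} [Group G] {A B : Subgroup G}
    (hAB : Subgroup.IsComplement' A B) {a a' b b' : G} (ha : a ∈ A) (ha' : a' ∈ A) (hb : b ∈ B)
    (hb' : b' ∈ B) (h : a * b = a' * b') : a = a' ∧ b = b' := by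
  have := @hAB.1 (⟨a, ha⟩, ⟨b, hb⟩) (⟨a', ha'⟩, ⟨b', hb'⟩) h
  simpa using this

theorem exists_reduction_comorphism (A B : Subgroup Xˣ) (hA : ∀ a ∈ A, ∀ a' ∈ A, a * a' = a' * a)
    (hB : ∀ b ∈ B, ∀ b' ∈ B, b * b' = b' * b) (hAB : Subgroup.IsComplement' A B)
    (f : X → K) (hf : f ∈ coordRing K X) : ∃ F ∈ coordRing K (X × X),
      ∀ a ∈ A, ∀ b ∈ B, ∀ x : X, F (((a * b : Xˣ) : X), x) = f (a * x * b) ∧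
        F (x, ((a * b : Xˣ) : X)) = f (a * x * b) := by
  obtain ⟨W, hW1, hW2, hW3⟩ := exists_finite_translates (K := K) f hf
  have : FiniteDimensional K W := Module.Finite.of_fg hW1
  have hcomm : ∀ a ∈ A, ∀ a' ∈ A, (a : X) * a' = a' * a := fun a ha a' ha' => by
    exact_mod_cast congrArg Units.val (hA a ha a' ha')
  have hcomm' : ∀ a ∈ B, ∀ a' ∈ B, (a : X) * a' = a' * a := fun a ha a' ha' => by
    exact_mod_cast congrArg Units.val (hB a ha a' ha')
  have hsym : ∀ a ∈ A, ∀ b ∈ B, ∀ a' ∈ A, ∀ b' ∈ B,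
      (a : X) * ((a' : X) * b') * b = a' * ((a : X) * b) * b' := by
    intro a ha b hb a' ha' b' hb'
    calc (a : X) * ((a' : X) * b') * b = (a * a') * (b' * b) := by simp only [mul_assoc]
      _ = (a' * a) * (b * b') := by rw [hcomm a ha a' ha', hcomm' b' hb' b hb]
      _ = a' * ((a : X) * b) * b' := by simp only [mul_assoc]
  choose p hp q hq hpq using exists_mul_decomposition hAB
  let e := Module.finBasis K W
  let F0 : Xˣ → W := fun g => ⟨fun x => f (p g * x * q g), hW3 _ _⟩
  have htr : ∀ a b : X, (fun x => f (a * x * b)) ∈ coordRing K X := fun a b => hW2 (hW3 a b)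
  have key : ∀ i, ∃ c ∈ coordRing K X, ∀ g : Xˣ, c g = e.coord i (F0 g) := by
    intro i
    refine exists_regular_of_functional W (Set.range (Units.val : Xˣ → X)) ?_ Units.val F0 ?_ _
    · intro w hw h
      exact eq_of_eqOn_units (hW2 hw) (zero_mem _) fun g => h g ⟨g, rfl⟩
    · rintro _ ⟨s, rfl⟩
      refine ⟨_, htr (p s) (q s), fun g => ?_⟩
      show f (p s * g * q s) = f (p g * s * q g)
      conv_lhs => rw [hpq g]
      conv_rhs => rw [hpq s]
      rw [Units.val_mul, Units.val_mul, hsym _ (hp s) _ (hq s) _ (hp g) _ (hq g)]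
  choose c hc hc' using key
  refine ⟨∑ i, pullback K Prod.fst (c i) * pullback K Prod.snd (e i).1,
    sum_mem fun i _ => mul_mem (isMorphism_fst _ (hc i)) (isMorphism_snd _ (hW2 (e i).2)), ?_⟩
  intro a ha b hb
  have hpqab : p (a * b) = a ∧ q (a * b) = b :=
    mul_decomposition_inj hAB (hp _) ha (hq _) hb (hpq _).symm
  have hF : ∀ (g : Xˣ) (x : X), (∑ i, pullback K Prod.fst (c i) * pullback K Prod.snd (e i).1 :
      X × X → K) (↑g, x) = f (p g * x * q g) := by
    intro g x
    have h := congrFun (congrArg Subtype.val (e.sum_repr (F0 g))) x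
    simp only [Finset.sum_apply, Pi.mul_apply, pullback_apply, hc']
    refine Eq.trans ?_ h
    rw [AddSubmonoidClass.coe_finsetSum, Finset.sum_apply]
    rfl
  have h2 : (fun x : X => (∑ i, pullback K Prod.fst (c i) * pullback K Prod.snd (e i).1 :
      X × X → K) (x, ((a * b : Xˣ) : X))) = fun x => f (a * x * b) := by
    apply eq_of_eqOn_units
    · refine isMorphism_prodMk isMorphism_id (isMorphism_const ((a * b : Xˣ) : X))
        (∑ i, pullback K Prod.fst (c i) * pullback K Prod.snd (e i).1) ?_
      exact
        (sum_mem fun i _ => mul_mem (isMorphism_fst _ (hc i)) (isMorphism_snd _ (hW2 (e i).2)))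
    · exact htr a b
    · intro g
      show _ = f (a * g * b)
      rw [hF]
      conv_rhs => rw [hpq g]
      rw [Units.val_mul, Units.val_mul, hsym _ (hp g) _ (hq g) _ ha _ hb]
  intro x
  refine ⟨?_, congrFun h2 x⟩
  rw [hF, hpqab.1, hpqab.2]

/-- Let the group `Xˣ` be the product `A B` of commutative subgroups with `A ∩ B = 1`.
Then the maps `Xˣ × X → X`, `(a * b, x) ↦ a * x * b`, and `X × Xˣ → X`, `(x, a * b) ↦ a * x * b`,
extend to a morphism `X × X → X`. -/
theorem exists_reduction_mul (A B : Subgroup Xˣ) (hA : ∀ a ∈ A, ∀ a' ∈ A, a * a' = a' * a)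
    (hB : ∀ b ∈ B, ∀ b' ∈ B, b * b' = b' * b) (hAB : Subgroup.IsComplement' A B) :
    ∃ m : X → X → X, IsMorphism K (fun p : X × X => m p.1 p.2) ∧
      ∀ a ∈ A, ∀ b ∈ B, ∀ x : X, m ((a * b : Xˣ) : X) x = a * x * b ∧
        m x ((a * b : Xˣ) : X) = a * x * b := by
  choose! F hF hF' using exists_reduction_comorphism (K := K) A B hA hB hAB
  have hval : ∀ f ∈ coordRing K X, ∀ g g' : Xˣ, ∃ a ∈ A, ∃ b ∈ B, g = a * b ∧
      F f (↑g, ↑g') = f (a * g' * b) := by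
    intro f hf g g'
    obtain ⟨a, ha, b, hb, rfl⟩ := exists_mul_decomposition hAB g
    exact ⟨a, ha, b, hb, rfl, (hF' f hf a ha b hb g').1⟩
  have hlin : ∀ f ∈ coordRing K X, ∀ F' ∈ coordRing K (X × X),
      (∀ a ∈ A, ∀ b ∈ B, ∀ x : X, F' (((a * b : Xˣ) : X), x) = f (a * x * b)) → F f = F' := by
    intro f hf F' hF'' h
    apply eq_of_eqOn_units_prod (hF f hf) hF''
    intro g g'
    obtain ⟨a, ha, b, hb, rfl⟩ := exists_mul_decomposition hAB g
    rw [(hF' f hf a ha b hb g').1, h a ha b hb]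
  have hpoint : ∀ p : X × X, ∃ x : X, ∀ f ∈ coordRing K X, F f p = f x := by
    intro p
    let φ : coordRing K X →ₐ[K] K :=
      { toFun := fun f => F f.1 p
        map_one' := by
          show F 1 p = 1
          rw [hlin 1 (one_mem _) 1 (one_mem _) fun _ _ _ _ _ => rfl]; rfl
        map_zero' := by
          show F 0 p = 0
          rw [hlin 0 (zero_mem _) 0 (zero_mem _) fun _ _ _ _ _ => rfl]; rfl
        map_mul' := fun f g => by
          show F (f.1 * g.1) p = F f.1 p * F g.1 p
          rw [hlin (f.1 * g.1) (mul_mem f.2 g.2) (F f.1 * F g.1) (mul_mem (hF _ f.2) (hF _ g.2))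
            fun a ha b hb x => by
              rw [Pi.mul_apply, (hF' _ f.2 a ha b hb x).1, (hF' _ g.2 a ha b hb x).1]; rfl]
          rfl
        map_add' := fun f g => by
          show F (f.1 + g.1) p = F f.1 p + F g.1 p
          rw [hlin (f.1 + g.1) (add_mem f.2 g.2) (F f.1 + F g.1) (add_mem (hF _ f.2) (hF _ g.2))
            fun a ha b hb x => by
              rw [Pi.add_apply, (hF' _ f.2 a ha b hb x).1, (hF' _ g.2 a ha b hb x).1]; rfl]
          rfl
        commutes' := fun c => by
          show F (algebraMap K (X → K) c) p = c
          rw [hlin _ (Subalgebra.algebraMap_mem _ c) (algebraMap K (X × X → K) c)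
            (Subalgebra.algebraMap_mem _ c) fun _ _ _ _ _ => rfl]
          rfl }
    obtain ⟨x, hx⟩ := exists_point φ
    exact ⟨x, fun f hf => hx ⟨f, hf⟩⟩
  choose m hm using hpoint
  refine ⟨fun x y => m (x, y), ?_, fun a ha b hb x => ⟨?_, ?_⟩⟩
  · intro f hf
    have : pullback K (fun p : X × X => m (p.1, p.2)) f = F f := by
      funext p
      exact (hm p f hf).symm
    rw [this]
    exact hF f hf
  · apply point_ext (K := K)
    intro f hf
    rw [← hm _ f hf, (hF' f hf a ha b hb x).1]
  · apply point_ext (K := K)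
    intro f hf
    rw [← hm _ f hf, (hF' f hf a ha b hb x).2]

variable (K) in
/-- The morphism `X × X → X` that extends the maps `Xˣ × X → X`, `(a * b, x) ↦ a * x * b`, and
`X × Xˣ → X`, `(x, a * b) ↦ a * x * b`, where `a ∈ A` and `b ∈ B`. It is unique, because the group
`Xˣ` of invertible elements is dense in `X`. -/
noncomputable def reductionMul (A B : Subgroup Xˣ)
    (hA : ∀ a ∈ A, ∀ a' ∈ A, a * a' = a' * a) (hB : ∀ b ∈ B, ∀ b' ∈ B, b * b' = b' * b)
    (hAB : Subgroup.IsComplement' A B) : X → X → X :=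
  Classical.choose (exists_reduction_mul (K := K) A B hA hB hAB)

section

variable {A B : Subgroup Xˣ} {hA : ∀ a ∈ A, ∀ a' ∈ A, a * a' = a' * a}
  {hB : ∀ b ∈ B, ∀ b' ∈ B, b * b' = b' * b} {hAB : Subgroup.IsComplement' A B}

theorem isMorphism_reductionMul :
    IsMorphism K (fun p : X × X => reductionMul K A B hA hB hAB p.1 p.2) :=
  (Classical.choose_spec (exists_reduction_mul (K := K) A B hA hB hAB)).1

theorem reductionMul_left {a b : Xˣ} (ha : a ∈ A) (hb : b ∈ B) (x : X) :
    reductionMul K A B hA hB hAB ((a * b : Xˣ) : X) x = a * x * b :=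
  ((Classical.choose_spec (exists_reduction_mul (K := K) A B hA hB hAB)).2 a ha b hb x).1

theorem reductionMul_right {a b : Xˣ} (ha : a ∈ A) (hb : b ∈ B) (x : X) :
    reductionMul K A B hA hB hAB x ((a * b : Xˣ) : X) = a * x * b :=
  ((Classical.choose_spec (exists_reduction_mul (K := K) A B hA hB hAB)).2 a ha b hb x).2

theorem isMorphism_reductionMul_comp {Z : Type*} [AffineVariety K Z] {φ ψ : Z → X}
    (hφ : IsMorphism K φ) (hψ : IsMorphism K ψ) :
    IsMorphism K (fun z => reductionMul K A B hA hB hAB (φ z) (ψ z)) :=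
  isMorphism_comp (isMorphism_reductionMul (A := A) (B := B) (hA := hA) (hB := hB) (hAB := hAB))
    (isMorphism_prodMk hφ hψ)

theorem reductionMul_comm (x y : X) :
    reductionMul K A B hA hB hAB x y = reductionMul K A B hA hB hAB y x := by
  refine congrFun (morphism_eq_of_eqOn_units (K := K)
    (φ := fun x => reductionMul K A B hA hB hAB x y)
    (ψ := fun x => reductionMul K A B hA hB hAB y x)
    (isMorphism_reductionMul_comp isMorphism_id (isMorphism_const y))
    (isMorphism_reductionMul_comp (isMorphism_const y) isMorphism_id) fun g => ?_) x
  obtain ⟨a, ha, b, hb, rfl⟩ := exists_mul_decomposition hAB g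
  simp only [reductionMul_left ha hb, reductionMul_right ha hb]

theorem one_reductionMul (x : X) : reductionMul K A B hA hB hAB 1 x = x := by
  have h := reductionMul_left (K := K) (hA := hA) (hB := hB) (hAB := hAB) A.one_mem B.one_mem x
  simpa using h

theorem reductionMul_assoc (x y z : X) :
    reductionMul K A B hA hB hAB (reductionMul K A B hA hB hAB x y) z =
      reductionMul K A B hA hB hAB x (reductionMul K A B hA hB hAB y z) := by
  have hcomm : ∀ a ∈ A, ∀ a' ∈ A, (a : X) * a' = a' * a := fun a ha a' ha' => by
    exact_mod_cast congrArg Units.val (hA a ha a' ha')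
  have hcomm' : ∀ a ∈ B, ∀ a' ∈ B, (a : X) * a' = a' * a := fun a ha a' ha' => by
    exact_mod_cast congrArg Units.val (hB a ha a' ha')
  have h1 : ∀ (g h : Xˣ) (y : X),
      reductionMul K A B hA hB hAB (reductionMul K A B hA hB hAB g y) h =
        reductionMul K A B hA hB hAB g (reductionMul K A B hA hB hAB y h) := by
    intro g h y
    obtain ⟨a, ha, b, hb, rfl⟩ := exists_mul_decomposition hAB g
    obtain ⟨a', ha', b', hb', rfl⟩ := exists_mul_decomposition hAB h
    rw [reductionMul_left ha hb, reductionMul_right ha' hb', reductionMul_right ha' hb',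
      reductionMul_left ha hb]
    calc (a' : X) * (a * y * b) * b' = (a' * a) * y * (b * b') := by simp only [mul_assoc]
      _ = (a * a') * y * (b' * b) := by rw [hcomm a ha a' ha', hcomm' b' hb' b hb]
      _ = _ := by simp only [mul_assoc]
  have h2 : ∀ (g : Xˣ) (y z : X),
      reductionMul K A B hA hB hAB (reductionMul K A B hA hB hAB g y) z =
        reductionMul K A B hA hB hAB g (reductionMul K A B hA hB hAB y z) := fun g y z =>
    congrFun (morphism_eq_of_eqOn_units (K := K)
      (isMorphism_reductionMul_comp (isMorphism_const _) isMorphism_id)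
      (isMorphism_reductionMul_comp (isMorphism_const _)
        (isMorphism_reductionMul_comp (isMorphism_const _) isMorphism_id))
      fun h => h1 g h y) z
  exact congrFun (morphism_eq_of_eqOn_units (K := K)
    (isMorphism_reductionMul_comp
      (isMorphism_reductionMul_comp isMorphism_id (isMorphism_const _)) (isMorphism_const _))
    (isMorphism_reductionMul_comp isMorphism_id (isMorphism_const _))
    fun g => h2 g y z) x

end

variable (K) in
/-- The commutative monoid structure on `X` whose multiplication is `reductionMul`. -/
@[reducible]
noncomputable def reductionMonoid (A B : Subgroup Xˣ)
    (hA : ∀ a ∈ A, ∀ a' ∈ A, a * a' = a' * a) (hB : ∀ b ∈ B, ∀ b' ∈ B, b * b' = b' * b)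
    (hAB : Subgroup.IsComplement' A B) : CommMonoid X where
  mul := reductionMul K A B hA hB hAB
  one := 1
  mul_assoc := reductionMul_assoc
  one_mul := one_reductionMul
  mul_one x := (reductionMul_comm x 1).trans (one_reductionMul x)
  mul_comm := reductionMul_comm
  npow := @npowRec X ⟨1⟩ ⟨reductionMul K A B hA hB hAB⟩

end

end CommutativeReduction

open CommutativeReduction

section

variable {K : Type*} [Field K] {X : Type*} [AffineVariety K X] [Monoid X]

/-- The left commutative reduction of the algebraic monoid `X` with respect to a decomposition
`Xˣ = T ⋉ U`: the variety `X` with the commutative multiplication that extends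
`(t * u, x) ↦ t * x * u` and `(x, t * u) ↦ t * x * u`, where `t ∈ T` and `u ∈ U`. -/
def LeftReduction (_D : SemidirectDecomposition K X) : Type _ := X

/-- The right commutative reduction of the algebraic monoid `X` with respect to a decomposition
`Xˣ = T ⋉ U`: the variety `X` with the commutative multiplication that extends
`(v * t, x) ↦ v * x * t` and `(x, v * t) ↦ v * x * t`, where `v ∈ U` and `t ∈ T`. -/
def RightReduction (_D : SemidirectDecomposition K X) : Type _ := X

instance LeftReduction.instAffineVariety (D : SemidirectDecomposition K X) :
    AffineVariety K (LeftReduction D) := inferInstanceAs (AffineVariety K X)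

instance RightReduction.instAffineVariety (D : SemidirectDecomposition K X) :
    AffineVariety K (RightReduction D) := inferInstanceAs (AffineVariety K X)

variable [IsAlgebraicMonoid K X] [IsDomain (coordRing K X)]

noncomputable instance LeftReduction.instCommMonoid (D : SemidirectDecomposition K X) :
    CommMonoid (LeftReduction D) :=
  reductionMonoid (X := X) K D.T D.U D.comm_T D.comm_U D.isComplement

noncomputable instance RightReduction.instCommMonoid (D : SemidirectDecomposition K X) :
    CommMonoid (RightReduction D) :=
  reductionMonoid (X := X) K D.U D.T D.comm_U D.comm_T D.isComplement.symm

instance LeftReduction.instIsAlgebraicMonoid (D : SemidirectDecomposition K X) :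
    IsAlgebraicMonoid K (LeftReduction D) where
  isMorphism_mul := isMorphism_reductionMul (K := K) (X := X) (hA := D.comm_T) (hB := D.comm_U)
    (hAB := D.isComplement)

instance RightReduction.instIsAlgebraicMonoid (D : SemidirectDecomposition K X) :
    IsAlgebraicMonoid K (RightReduction D) where
  isMorphism_mul := isMorphism_reductionMul (K := K) (X := X) (hA := D.comm_U) (hB := D.comm_T)
    (hAB := D.isComplement.symm)

end

/-! An isomorphism `ψ` that carries `D.T` into `E.T` and `D.U` into `E.U` is multiplicative for both
reductions: for invertible `x = a * b` both sides equal `ψ a * ψ y * ψ b`, and the invertible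
elements are dense (`map_reductionMul`). It therefore suffices to correct the given isomorphism by
an inner automorphism of `Y`.

The unipotent factor needs no correction. Regular functions of `u ^ k` are rational in `k` for `u`
unipotent, whereas a coordinate of the torus part of `g ^ k` is a geometric sequence `c ^ k`, which
in characteristic zero is rational in `k` only for `c = 1` (`mem_U_of_pow_mem_rationalSeq`).

The torus is moved by a conjugation (`exists_conj_mem_T`). On its `m`-torsion, a finite group, the
embedding and its projection to `E.T` differ by a cocycle in `E.U`, where the order of that group is
invertible; averaging turns the cocycle into a coboundary (`exists_mul_eq_mul_of_finite`). The
conjugating elements are the unipotent solutions of regular equations on `Y`, so by the Noetherian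
property a single one serves all torsion. Torsion is dense in the torus and `E.T` is closed, so the
whole torus follows. -/

/-! ### Sequences that are rational functions of the index -/

open Polynomial in
/-- The sequences `s : ℕ → K` for which `s k = P k / Q k` wherever `Q k ≠ 0`, for some polynomials
`P` and `Q` with `Q 0 ≠ 0`. -/
def rationalSeq (K : Type*) [Field K] : Subalgebra K (ℕ → K) where
  -- Mere `Q ≠ 0` would leave the term at index 0 free. It has to be controlled: local regularity is
  -- used at the point of index 0, and a denominator that is non-zero there must have a numerator
  -- polynomial that is non-zero at 0.
  carrier := {s | ∃ P Q : K[X], Q.eval 0 ≠ 0 ∧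
    ∀ k : ℕ, Q.eval (k : K) ≠ 0 → s k * Q.eval (k : K) = P.eval (k : K)}
  mul_mem' := by
    rintro s s' ⟨P, Q, hQ, h⟩ ⟨P', Q', hQ', h'⟩
    refine ⟨P * P', Q * Q', by simp [hQ, hQ'], fun k hk => ?_⟩
    rw [eval_mul] at hk
    have h1 := h k (left_ne_zero_of_mul hk)
    have h2 := h' k (right_ne_zero_of_mul hk)
    rw [eval_mul, eval_mul, ← h1, ← h2, Pi.mul_apply]
    ring
  add_mem' := by
    rintro s s' ⟨P, Q, hQ, h⟩ ⟨P', Q', hQ', h'⟩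
    refine ⟨P * Q' + P' * Q, Q * Q', by simp [hQ, hQ'], fun k hk => ?_⟩
    rw [eval_mul] at hk
    have h1 := h k (left_ne_zero_of_mul hk)
    have h2 := h' k (right_ne_zero_of_mul hk)
    rw [eval_add, eval_mul, eval_mul, eval_mul, ← h1, ← h2, Pi.add_apply]
    ring
  algebraMap_mem' c := ⟨C c, 1, by simp, fun k _ => by simp⟩

section

variable {K : Type*} [Field K]

open Polynomial in
theorem eval_mem_rationalSeq (P : K[X]) : (fun k : ℕ => P.eval (k : K)) ∈ rationalSeq K :=
  ⟨P, 1, by simp, fun k _ => by simp⟩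

open Polynomial in
/-- Locally regular functions take sequences of points with rational coordinates to rational
sequences. -/
theorem AffineVariety.IsRegularOn.comp_mem_rationalSeq {Z X : Type*} [AffineVariety K X] {i : Z → X}
    {h : Z → K} (hh : IsRegularOn K i h) {z : ℕ → Z}
    (hz : ∀ f ∈ coordRing K X, (fun k => f (i (z k))) ∈ rationalSeq K) :
    (fun k => h (z k)) ∈ rationalSeq K := by
  obtain ⟨f, hf, g, hg, hg0, hfg⟩ := hh (z 0)
  obtain ⟨P, Q, hQ, hP⟩ := hz f hf
  obtain ⟨P', Q', hQ', hP'⟩ := hz g hg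
  have hP0 : P'.eval 0 ≠ 0 := by
    have := hP' 0 (by simpa using hQ')
    simp only [Nat.cast_zero] at this
    rw [← this]
    exact mul_ne_zero hg0 hQ'
  -- With `f = P / Q` and `g = P' / Q'` the quotient is `P Q' / (Q P')`. The extra factor `Q'` on
  -- both sides excludes the indices at which `g` is not known to equal `P' / Q'`.
  refine ⟨P * Q' * Q', Q * P' * Q', by simp [hQ, hP0, hQ'], fun k hk => ?_⟩
  simp only [eval_mul] at hk ⊢
  have hQ'k := right_ne_zero_of_mul hk
  have hP'k := right_ne_zero_of_mul (left_ne_zero_of_mul hk)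
  have h1 := hP k (left_ne_zero_of_mul (left_ne_zero_of_mul hk))
  have h2 := hP' k hQ'k
  have hgk : g (i (z k)) ≠ 0 := by
    intro h0
    simp only [h0, zero_mul] at h2
    exact hP'k h2.symm
  simp only [hfg _ hgk, ← h1, ← h2]
  field_simp

open Polynomial in
/-- A geometric sequence that is a rational function of the index is constant. -/
theorem eq_one_of_pow_mem_rationalSeq [CharZero K] {c : K}
    (h : (fun k : ℕ => c ^ k) ∈ rationalSeq K) : c = 1 := by
  obtain ⟨P, Q, hQ, hP⟩ := h
  have hQ0 : Q ≠ 0 := by rintro rfl; simp at hQ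
  have hP0 : P ≠ 0 := by
    rintro rfl
    have := hP 0 (by simpa using hQ)
    simp only [pow_zero, one_mul, eval_zero, Nat.cast_zero] at this
    exact hQ this
  have hR0 : taylor 1 Q ≠ 0 := by simpa using hQ0
  have hev : ∀ (p : K[X]) (k : ℕ), (taylor 1 p).eval (k : K) = p.eval ((k + 1 : ℕ) : K) := by
    intro p k
    simp [taylor_eval]
  -- This is `s (k + 1) = c * s k` with denominators cleared; the factor `Q * taylor 1 Q` makes it
  -- hold trivially where a denominator vanishes. A shift preserves leading coefficients, so
  -- comparing them gives `c = 1`.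
  have hkey : (taylor 1 P * Q) * (Q * taylor 1 Q) = (C c * P * taylor 1 Q) * (Q * taylor 1 Q) := by
    apply eq_of_infinite_eval_eq
    refine (Set.infinite_range_of_injective (Nat.cast_injective (R := K))).mono ?_
    rintro _ ⟨k, rfl⟩
    simp only [Set.mem_ofPred_eq, eval_mul, hev, eval_C]
    by_cases h1 : Q.eval (k : K) = 0
    · simp [h1]
    by_cases h2 : Q.eval ((k + 1 : ℕ) : K) = 0
    · simp only [h2]; ring
    simp only [← hP _ h1, ← hP _ h2, pow_succ]
    ring
  have := mul_right_cancel₀ (mul_ne_zero hQ0 hR0) hkey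
  have := congrArg leadingCoeff this
  simp only [leadingCoeff_mul, leadingCoeff_taylor, leadingCoeff_C] at this
  have h3 : (1 - c) * (P.leadingCoeff * Q.leadingCoeff) = 0 := by linear_combination this
  rcases mul_eq_zero.1 h3 with h4 | h4
  · exact (sub_eq_zero.1 h4).symm
  · simp [hP0, hQ0] at h4

/-! ### Powers of unipotent matrices -/

open Polynomial in
/-- The powers of a unipotent matrix are polynomial functions of the exponent. -/
theorem exists_polynomial_pow [CharZero K] {n : Type*} [Fintype n] [DecidableEq n]
    {M : Matrix n n K} (hM : IsNilpotent (M - 1)) :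
    ∃ p : n → n → K[X], ∀ (k : ℕ) i j, (M ^ k) i j = (p i j).eval (k : K) := by
  obtain ⟨d, hd⟩ := hM
  refine ⟨fun i j => ∑ m ∈ Finset.range d,
    C (((M - 1) ^ m) i j * ((m.factorial : K))⁻¹) * descPochhammer K m, fun k i j => ?_⟩
  -- The binomial expansion around 1 stops at a bound `d` independent of `k`, and each binomial
  -- coefficient is a polynomial in `k`.
  have h1 : M ^ k = ∑ m ∈ Finset.range d, (k.choose m : K) • (M - 1) ^ m := by
    have h2 : M ^ k = ∑ m ∈ Finset.range (k + 1), (k.choose m : K) • (M - 1) ^ m := by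
      conv_lhs => rw [← sub_add_cancel M 1]
      rw [(Commute.one_right _).add_pow]
      refine Finset.sum_congr rfl fun m _ => ?_
      rw [one_pow, mul_one, Nat.cast_smul_eq_nsmul, nsmul_eq_mul, (Nat.cast_commute _ _).eq]
    rw [h2]
    -- A common longer range: beyond `k` the binomial coefficients vanish, from `d` on the powers of
    -- `M - 1` do.
    trans ∑ m ∈ Finset.range (k + 1 + d), (k.choose m : K) • (M - 1) ^ m
    · refine Finset.sum_subset (Finset.range_mono (by omega)) fun m _ hm => ?_
      rw [Nat.choose_eq_zero_of_lt (by simpa using hm), Nat.cast_zero, zero_smul]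
    · refine (Finset.sum_subset (Finset.range_mono (by omega)) fun m _ hm => ?_).symm
      rw [pow_eq_zero_of_le (by simpa using hm) hd, smul_zero]
  rw [h1, Matrix.sum_apply, eval_finsetSum]
  refine Finset.sum_congr rfl fun m _ => ?_
  rw [eval_mul, eval_C, descPochhammer_eval_eq_descFactorial,
    Nat.descFactorial_eq_factorial_mul_choose, Matrix.smul_apply, smul_eq_mul, Nat.cast_mul]
  have : (m.factorial : K) ≠ 0 := Nat.cast_ne_zero.2 m.factorial_ne_zero
  field_simp

open Polynomial in
theorem exists_polynomial_comp_matrix {n : Type*} [Finite n] (p : n → n → K[X])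
    {f : Matrix n n K → K} (hf : f ∈ coordRing K (Matrix n n K)) :
    ∃ q : K[X], ∀ x, f (Matrix.of fun i j => (p i j).eval x) = q.eval x := by
  change f ∈ Algebra.adjoin K _ at hf
  induction hf using Algebra.adjoin_induction with
  | mem f hf =>
    obtain ⟨⟨i, j⟩, rfl⟩ := hf
    exact ⟨p i j, fun x => rfl⟩
  | algebraMap c => exact ⟨C c, fun x => by simp⟩
  | add f g _ _ hf hg =>
    obtain ⟨q, hq⟩ := hf
    obtain ⟨r, hr⟩ := hg
    exact ⟨q + r, fun x => by simp [hq, hr]⟩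
  | mul f g _ _ hf hg =>
    obtain ⟨q, hq⟩ := hf
    obtain ⟨r, hr⟩ := hg
    exact ⟨q * r, fun x => by simp [hq, hr]⟩

-- The natural numbers are Zariski dense in the line. Through this, identities between powers `M ^
-- k` pass to arbitrary scalar exponents.
open Polynomial in
theorem eq_of_eval_natCast_eq [CharZero K] {p q : K[X]}
    (h : ∀ k : ℕ, p.eval (k : K) = q.eval (k : K)) : p = q := by
  apply eq_of_infinite_eval_eq
  refine (Set.infinite_range_of_injective (Nat.cast_injective (R := K))).mono ?_
  rintro _ ⟨k, rfl⟩
  exact h k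

open Polynomial in
/-- The one-parameter subgroup through a unipotent matrix. -/
theorem exists_polynomial_oneParameter [CharZero K] {n : Type*} [Fintype n] [DecidableEq n]
    {M : Matrix n n K} (hM : IsNilpotent (M - 1)) :
    ∃ p : n → n → K[X], (∀ k : ℕ, (Matrix.of fun i j => (p i j).eval (k : K)) = M ^ k) ∧
      ∀ x y : K, (Matrix.of fun i j => (p i j).eval (x + y)) =
        (Matrix.of fun i j => (p i j).eval x) * (Matrix.of fun i j => (p i j).eval y) := by
  obtain ⟨p, hp⟩ := exists_polynomial_pow hM
  have hp' : ∀ k : ℕ, (Matrix.of fun i j => (p i j).eval (k : K)) = M ^ k := fun k => by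
    ext i j; simp [hp]
  refine ⟨p, hp', ?_⟩
  -- The exponential law is known for natural exponents; it is extended one variable at a time, here
  -- in the second and afterwards in the first.
  have h1 : ∀ (k : ℕ) (y : K), (Matrix.of fun i j => (p i j).eval ((k : K) + y)) =
      (Matrix.of fun i j => (p i j).eval (k : K)) * (Matrix.of fun i j => (p i j).eval y) := by
    intro k y
    ext i j
    have : (p i j).comp (C (k : K) + X) = ∑ l, C ((p i l).eval (k : K)) * p l j := by
      apply eq_of_eval_natCast_eq
      intro m
      have h := congrFun (congrFun (pow_add M k m) i) j
      rw [Matrix.mul_apply] at h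
      simp only [hp, Nat.cast_add] at h
      simpa [eval_finsetSum] using h
    have := congrArg (eval y) this
    simpa [eval_finsetSum, Matrix.mul_apply] using this
  intro x y
  ext i j
  have : (p i j).comp (X + C y) = ∑ l, p i l * C ((p l j).eval y) := by
    apply eq_of_eval_natCast_eq
    intro m
    have h := congrFun (congrFun (h1 m y) i) j
    rw [Matrix.mul_apply] at h
    simpa [eval_finsetSum] using h
  have := congrArg (eval x) this
  simpa [eval_finsetSum, Matrix.mul_apply] using this

/-- The root is the value at `1 / m` of the one-parameter subgroup through `M`. Along that subgroup
an equation of `H` becomes a polynomial vanishing at all natural numbers, because the powers of `M`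
lie in `H`; hence it vanishes at `1 / m` too. -/
theorem exists_pow_eq_of_isNilpotent_sub_one [CharZero K] {n : Type*} [Fintype n] [DecidableEq n]
    {H : Subgroup (Matrix n n K)ˣ} (hH : IsClosedSubgroup K H) {M : (Matrix n n K)ˣ} (hMH : M ∈ H)
    (hM : IsNilpotent ((M : Matrix n n K) - 1)) {m : ℕ} (hm : m ≠ 0) : ∃ N ∈ H, N ^ m = M := by
  obtain ⟨p, hp, hadd⟩ := exists_polynomial_oneParameter hM
  set E : K → Matrix n n K := fun x => Matrix.of fun i j => (p i j).eval x with hE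
  have hE0 : E 0 = 1 := by simpa using hp 0
  have hmul : ∀ x y, E (x + y) = E x * E y := hadd
  let e : K → (Matrix n n K)ˣ := fun x =>
    ⟨E x, E (-x), by rw [← hmul, add_neg_cancel, hE0], by rw [← hmul, neg_add_cancel, hE0]⟩
  have hpow : ∀ (k : ℕ) x, E (k * x) = E x ^ k := by
    intro k x
    induction k with
    | zero => simp [hE0]
    | succ k ih => rw [Nat.cast_succ, add_mul, one_mul, hmul, ih, pow_succ]
  obtain ⟨S, hS, hS'⟩ := hH
  refine ⟨e (m : K)⁻¹, (hS' _).2 fun f hf => ?_, ?_⟩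
  · obtain ⟨q, hq⟩ := exists_polynomial_comp_matrix p (hS hf)
    have hq0 : q = 0 := by
      apply eq_of_eval_natCast_eq
      intro k
      rw [← hq, hp, ← Units.val_pow_eq_pow_val, Polynomial.eval_zero]
      exact (hS' _).1 (H.pow_mem hMH k) f hf
    exact (hq _).trans (by rw [hq0, Polynomial.eval_zero])
  · apply Units.ext
    show E _ ^ m = _
    rw [← hpow, mul_inv_cancel₀ (Nat.cast_ne_zero.2 hm)]
    simpa using hp 1

/-- The entries of `M ^ (m * k)` are polynomial in `k` and constant on natural numbers, hence
constant; the value at `k = 1 / m` is `M`. -/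
theorem eq_one_of_pow_eq_one_of_isNilpotent_sub_one [CharZero K] {n : Type*} [Fintype n]
    [DecidableEq n] {M : Matrix n n K} (hM : IsNilpotent (M - 1)) {m : ℕ} (hm : m ≠ 0)
    (h : M ^ m = 1) : M = 1 := by
  obtain ⟨p, hp⟩ := exists_polynomial_pow hM
  ext i j
  have hc : (p i j).comp (Polynomial.C (m : K) * Polynomial.X) =
      Polynomial.C ((1 : Matrix n n K) i j) := by
    apply eq_of_eval_natCast_eq
    intro k
    have := hp (m * k) i j
    rw [pow_mul, h, one_pow] at this
    simp [this]
  have := congrArg (Polynomial.eval ((m : K)⁻¹)) hc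
  have h1 := hp 1 i j
  simp only [Polynomial.eval_comp, Polynomial.eval_mul, Polynomial.eval_C, Polynomial.eval_X,
    mul_inv_cancel₀ (Nat.cast_ne_zero.2 hm : (m : K) ≠ 0)] at this
  rw [pow_one, Nat.cast_one] at h1
  rw [h1, this]

/-! ### Powers, roots and torsion in unipotent groups -/

section

variable {X : Type*} [AffineVariety K X] [Monoid X] {U : Subgroup Xˣ}

/-- The regular functions of `u ^ k` depend rationally on `k` if `u` lies in a unipotent group. -/
theorem IsUnipotentGroup.pow_mem_rationalSeq [CharZero K] (hU : IsUnipotentGroup K U) {u : Xˣ}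
    (hu : u ∈ U) {f : X → K} (hf : f ∈ coordRing K X) :
    (fun k : ℕ => f ((u ^ k : Xˣ) : X)) ∈ rationalSeq K := by
  obtain ⟨-, n, H', -, hnil, ⟨φ⟩⟩ := hU
  obtain ⟨p, hp⟩ := exists_polynomial_pow (hnil _ (φ.toMulEquiv ⟨u, hu⟩).2)
  -- In the matrix group the dependence on `k` is polynomial; the isomorphism back is only locally a
  -- quotient of regular functions, which leaves a rational dependence.
  have := (φ.isRegular_invFun f hf).comp_mem_rationalSeq
    (z := fun k => φ.toMulEquiv ⟨u, hu⟩ ^ k) fun g hg => by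
      obtain ⟨q, hq⟩ := exists_polynomial_comp_matrix p hg
      convert eval_mem_rationalSeq q using 2 with k
      rw [← hq]
      congr 1
      ext i j
      simp [subgroupInclusion, hp]
  convert this using 2 with k
  simp [subgroupInclusion, ← map_pow]

/-- Closedness of the matrix group keeps the root inside it. With the next lemma, `m`-th powers
become bijective on a commutative `U`, which is what averaging over a finite group requires. -/
theorem IsUnipotentGroup.exists_pow_eq [CharZero K] (hU : IsUnipotentGroup K U) {u : Xˣ}
    (hu : u ∈ U) {m : ℕ} (hm : m ≠ 0) : ∃ v ∈ U, v ^ m = u := by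
  obtain ⟨-, n, H', hcl, hnil, ⟨φ⟩⟩ := hU
  obtain ⟨N, hN, h⟩ := exists_pow_eq_of_isNilpotent_sub_one hcl (φ.toMulEquiv ⟨u, hu⟩).2
    (hnil _ (φ.toMulEquiv ⟨u, hu⟩).2) hm
  refine ⟨φ.toMulEquiv.symm ⟨N, hN⟩, SetLike.coe_mem _, ?_⟩
  have h' : (⟨N, hN⟩ : H') ^ m = φ.toMulEquiv ⟨u, hu⟩ := Subtype.ext h
  rw [← Subgroup.coe_pow, ← map_pow, h', MulEquiv.symm_apply_apply]

theorem IsUnipotentGroup.eq_one_of_pow_eq_one [CharZero K] (hU : IsUnipotentGroup K U) {u : Xˣ}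
    (hu : u ∈ U) {m : ℕ} (hm : m ≠ 0) (h : u ^ m = 1) : u = 1 := by
  obtain ⟨-, n, H', hcl, hnil, ⟨φ⟩⟩ := hU
  have h1 : (φ.toMulEquiv ⟨u, hu⟩) ^ m = 1 := by
    rw [← map_pow, show (⟨u, hu⟩ : U) ^ m = 1 from Subtype.ext h, map_one]
  have h2 := eq_one_of_pow_eq_one_of_isNilpotent_sub_one
    (hnil _ (φ.toMulEquiv ⟨u, hu⟩).2) hm (by
      rw [← Units.val_pow_eq_pow_val, ← Subgroup.coe_pow, h1]; rfl)
  have h3 : φ.toMulEquiv ⟨u, hu⟩ = 1 := Subtype.ext (Units.ext h2)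
  exact congrArg Subtype.val ((MulEquiv.map_eq_one_iff _).1 h3)

end

end
/-! ### Conjugacy of complements -/

/-- The projection of a semidirect product onto its non-normal factor. -/
noncomputable def complementProj {G : Type*} [Group G] {T U : Subgroup G}
    (h : Subgroup.IsComplement' T U) (hU : U.Normal) : G →* T :=
  MonoidHom.mk' (fun g => (h.equiv g).1) fun a b => by
    have h1 := h.equiv_fst_mul_equiv_snd a
    have h2 := h.equiv_fst_mul_equiv_snd b
    have h3 := h.equiv_fst_mul_equiv_snd (a * b)
    set t : T := (h.equiv a).1
    set t' : T := (h.equiv b).1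
    set u : U := (h.equiv a).2
    set u' : U := (h.equiv b).2
    -- `(t u) (t' u') = (t t') (t'⁻¹ u t' u')`, and the factorization is unique.
    refine Subtype.ext (mul_decomposition_inj h (SetLike.coe_mem _) (SetLike.coe_mem (t * t'))
      (SetLike.coe_mem _) (U.mul_mem (hU.conj_mem' _ u.2 (t' : G)) u'.2) (h3.trans ?_)).1
    rw [← h1, ← h2, Subgroup.coe_mul]
    group

section

variable {G : Type*} [Group G] {T U : Subgroup G} (h : Subgroup.IsComplement' T U) (hU : U.Normal)

theorem inv_mul_complementProj_mem (g : G) : g⁻¹ * complementProj h hU g ∈ U := by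
  have h1 := h.equiv_fst_mul_equiv_snd g
  have h2 : g⁻¹ * complementProj h hU g = ((h.equiv g).2 : G)⁻¹ := by
    rw [inv_mul_eq_iff_eq_mul, eq_mul_inv_iff_mul_eq]
    exact h1
  rw [h2]
  exact U.inv_mem (SetLike.coe_mem _)

theorem mem_of_complementProj_eq_one {g : G} (hg : complementProj h hU g = 1) : g ∈ U := by
  have := inv_mul_complementProj_mem h hU g
  rw [hg] at this
  simpa using this

end

/-- Two homomorphisms from a finite group that agree modulo a commutative normal subgroup `U` on
which the order of the group acts invertibly are conjugate by an element of `U`. -/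
theorem exists_mul_eq_mul_of_finite {F G : Type*} [Group F] [Finite F] [Group G] (U : Subgroup G)
    (hU : U.Normal) (hcomm : ∀ u ∈ U, ∀ u' ∈ U, u * u' = u' * u)
    (hdiv : ∀ u ∈ U, ∃ v ∈ U, v ^ Nat.card F = u)
    (htf : ∀ u ∈ U, u ^ Nat.card F = 1 → u = 1) (α β : F →* G)
    (hαβ : ∀ t, (α t)⁻¹ * β t ∈ U) : ∃ u ∈ U, ∀ t, u * α t = β t * u := by
  have := Fintype.ofFinite F
  let : CommGroup U :=
    { (inferInstance : Group U) with
      mul_comm := fun a b => Subtype.ext (hcomm a a.2 b b.2) }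
  -- `c` is a 1-cocycle for the right action `a` of `F` on `U` by conjugation through `α`.
  let c : F → U := fun t => ⟨_, hαβ t⟩
  let a : F → U →* U := fun s => (MulAut.conjNormal (α s)⁻¹ : MulAut U).toMonoidHom
  have ha : ∀ s (u : U), (a s u : G) = (α s)⁻¹ * u * α s := fun s u => by
    show ((MulAut.conjNormal (α s)⁻¹ u : U) : G) = _
    rw [MulAut.conjNormal_apply, inv_inv]
  have hc : ∀ t s, c (t * s) = a s (c t) * c s := fun t s => Subtype.ext (by
    rw [Subgroup.coe_mul, ha]
    show (α (t * s))⁻¹ * β (t * s) = (α s)⁻¹ * ((α t)⁻¹ * β t) * α s * ((α s)⁻¹ * β s)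
    rw [map_mul, map_mul]
    group)
  -- The cocycle identity multiplied over all `t`; right translation by `s` only permutes the
  -- factors.
  have hC : ∀ s, ∏ t, c t = a s (∏ t, c t) * c s ^ Nat.card F := by
    intro s
    conv_lhs => rw [← Equiv.prod_comp (Equiv.mulRight s)]
    simp only [Equiv.coe_mulRight, hc, Finset.prod_mul_distrib, map_prod, Finset.prod_const,
      Finset.card_univ, Nat.card_eq_fintype_card]
  -- A root `v` of the product trivializes `c`: `v` and `a s v * c s` have the same power of
  -- exponent `Nat.card F`, hence coincide. The conjugating element is `v⁻¹`.
  obtain ⟨v, hv, hvC⟩ := hdiv _ (∏ t, c t).2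
  have hvC' : (⟨v, hv⟩ : U) ^ Nat.card F = ∏ t, c t := Subtype.ext hvC
  refine ⟨v⁻¹, U.inv_mem hv, fun s => ?_⟩
  have h1 : (⟨v, hv⟩ * (a s ⟨v, hv⟩ * c s)⁻¹ : U) ^ Nat.card F = 1 := by
    rw [mul_pow, inv_pow, mul_pow, ← map_pow, hvC', ← hC s, mul_inv_cancel]
  have h2 := htf _ (SetLike.coe_mem _) (congrArg Subtype.val h1)
  rw [Subgroup.coe_mul, Subgroup.coe_inv, mul_inv_eq_one, Subgroup.coe_mul, ha] at h2
  change v = (α s)⁻¹ * v * α s * ((α s)⁻¹ * β s) at h2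
  have h3 : α s * v = v * β s := by
    conv_lhs => rw [h2]
    group
  rw [inv_mul_eq_iff_eq_mul, ← mul_assoc, ← h3, mul_assoc, mul_inv_cancel, mul_one]

/-! ### Torsion of tori -/

section

variable {K : Type*} [Field K]

theorem exists_mvPolynomial_eval {ι : Type*} [Finite ι] {f : (ι → K) → K}
    (hf : f ∈ coordRing K (ι → K)) : ∃ P : MvPolynomial ι K, ∀ x, f x = P.eval x := by
  change f ∈ Algebra.adjoin K _ at hf
  induction hf using Algebra.adjoin_induction with
  | mem f hf =>
    obtain ⟨i, rfl⟩ := hf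
    exact ⟨MvPolynomial.X i, fun x => by simp⟩
  | algebraMap c => exact ⟨MvPolynomial.C c, fun x => by simp⟩
  | add f g _ _ hf hg =>
    obtain ⟨q, hq⟩ := hf
    obtain ⟨r, hr⟩ := hg
    exact ⟨q + r, fun x => by simp [hq, hr]⟩
  | mul f g _ _ hf hg =>
    obtain ⟨q, hq⟩ := hf
    obtain ⟨r, hr⟩ := hg
    exact ⟨q * r, fun x => by simp [hq, hr]⟩

/-- Primitive roots of unity exist in every positive order, and their orders tell them apart. -/
theorem infinite_setOf_isOfFinOrder [IsAlgClosed K] [CharZero K] :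
    {x : K | IsOfFinOrder x}.Infinite := by
  choose ζ hζ using fun n : ℕ => HasEnoughRootsOfUnity.exists_primitiveRoot K (n + 1)
  refine Set.infinite_of_injective_forall_mem (f := ζ) (fun m n h => ?_) fun n => ?_
  · have h1 := (hζ m).eq_orderOf
    rw [h, ← (hζ n).eq_orderOf] at h1
    exact Nat.succ_injective h1
  · exact (hζ n).isOfFinOrder n.succ_ne_zero

/-- The elements of finite order are dense in `𝔾ₘᵖ`. -/
theorem eq_zero_of_forall_isOfFinOrder [IsAlgClosed K] [CharZero K] {ι : Type*} [Finite ι]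
    {h : (⊤ : Subgroup (ι → K)ˣ) → K}
    (hreg : IsRegularOn K (subgroupInclusion (⊤ : Subgroup (ι → K)ˣ)) h)
    (h0 : ∀ z, IsOfFinOrder z → h z = 0) (z) : h z = 0 := by
  have := Fintype.ofFinite ι
  obtain ⟨f, hf, g, hg, hgz, hfg⟩ := hreg z
  obtain ⟨P, hP⟩ := exists_mvPolynomial_eval hf
  obtain ⟨Q, hQ⟩ := exists_mvPolynomial_eval hg
  -- Tuples of roots of unity form a grid with infinite sides, on which no non-zero polynomial
  -- vanishes. The product is used because `h = P / Q` is available only where `Q` is non-zero.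
  have hPQ : P * Q = 0 := by
    refine MvPolynomial.funext_set (fun _ => {x : K | IsOfFinOrder x})
      (fun _ => infinite_setOf_isOfFinOrder) fun x hx => ?_
    have hx' : ∀ i, IsOfFinOrder (x i) := fun i => hx i trivial
    have hxm : x ^ (∏ i, orderOf (x i)) = 1 := by
      funext i
      exact orderOf_dvd_iff_pow_eq_one.1 (Finset.dvd_prod_of_mem _ (Finset.mem_univ i))
    have hm : ∏ i, orderOf (x i) ≠ 0 :=
      Finset.prod_ne_zero_iff.2 fun i _ => (hx' i).orderOf_pos.ne'
    let w : (⊤ : Subgroup (ι → K)ˣ) := ⟨Units.ofPowEqOne x _ hxm hm, trivial⟩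
    have hw : IsOfFinOrder w := isOfFinOrder_iff_pow_eq_one.2
      ⟨_, Nat.pos_of_ne_zero hm, Subtype.ext (Units.ext hxm)⟩
    rw [map_mul, map_zero, ← hP, ← hQ]
    by_cases hgx : g x = 0
    · rw [hgx, mul_zero]
    · have h1 : h w = f x / g x := hfg w hgx
      rw [h0 w hw, eq_comm, div_eq_zero_iff, or_iff_left hgx] at h1
      rw [h1, zero_mul]
  have hz := congrArg (MvPolynomial.eval (subgroupInclusion _ z)) hPQ
  rw [map_mul, map_zero, ← hP, ← hQ] at hz
  rw [hfg z hgz, (mul_eq_zero.1 hz).resolve_right hgz, zero_div]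

variable {X : Type*} [AffineVariety K X] [Monoid X] {T : Subgroup Xˣ}

/-- A regular function that vanishes on the elements of finite order of a torus vanishes on the
torus. -/
theorem IsTorus.eq_zero_of_forall_isOfFinOrder [IsAlgClosed K] [CharZero K] (hT : IsTorus K T)
    {f : X → K} (hf : f ∈ coordRing K X)
    (h0 : ∀ t : T, IsOfFinOrder t → f ((t : Xˣ) : X) = 0) (t : T) : f ((t : Xˣ) : X) = 0 := by
  obtain ⟨-, p, ⟨φ⟩⟩ := hT
  have := _root_.eq_zero_of_forall_isOfFinOrder (φ.isRegular_invFun f hf)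
    (fun z hz => h0 _ (φ.toMulEquiv.symm.toMonoidHom.isOfFinOrder hz)) (φ.toMulEquiv t)
  simpa [subgroupInclusion] using this

/-- Each coordinate is a root of `x ^ m - 1`. Finiteness is what allows averaging over the
`m`-torsion. -/
theorem IsTorus.finite_setOf_pow_eq_one (hT : IsTorus K T) {m : ℕ} (hm : m ≠ 0) :
    {t : T | t ^ m = 1}.Finite := by
  obtain ⟨-, p, ⟨φ⟩⟩ := hT
  have : NeZero m := ⟨hm⟩
  let c : T → Fin p → K := fun t => subgroupInclusion _ (φ.toMulEquiv t)
  have hc : Function.Injective c := fun t t' h =>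
    φ.toMulEquiv.injective (Subtype.ext (Units.ext h))
  refine Set.Finite.of_finite_image (f := c) ?_ hc.injOn
  refine (Set.Finite.pi' (t := fun _ : Fin p => {x : K | x ^ m = 1}) fun _ => ?_).subset ?_
  · have h := (Polynomial.X ^ m - Polynomial.C (1 : K)).finite_setOfPred_isRoot
      (Polynomial.X_pow_sub_C_ne_zero (Nat.pos_of_ne_zero hm) 1)
    refine h.subset fun x hx => ?_
    simpa [sub_eq_zero] using hx
  · rintro _ ⟨t, ht, rfl⟩ i
    have h1 : φ.toMulEquiv t ^ m = 1 := by
      rw [← map_pow, show t ^ m = 1 from ht, map_one]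
    have h2 : c t ^ m = 1 := congrArg (subgroupInclusion _) h1
    exact congrFun h2 i

end

/-! ### Uniqueness of the decomposition up to conjugation -/

section

variable {K : Type*} [Field K] {Y : Type*} [AffineVariety K Y] [Monoid Y]

/-- An element lies in the unipotent factor if the regular functions of its powers depend rationally
on the exponent. -/
theorem SemidirectDecomposition.mem_U_of_pow_mem_rationalSeq [CharZero K]
    (E : SemidirectDecomposition K Y) (hET : IsTorus K E.T) {g : Yˣ}
    (hg : ∀ f ∈ coordRing K Y, (fun k : ℕ => f ((g ^ k : Yˣ) : Y)) ∈ rationalSeq K) : g ∈ E.U := by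
  obtain ⟨-, p, ⟨φ⟩⟩ := hET
  let π := complementProj E.isComplement E.normal_U
  apply mem_of_complementProj_eq_one E.isComplement E.normal_U
  apply φ.toMulEquiv.injective
  rw [map_one]
  refine Subtype.ext (Units.ext (funext fun i => ?_))
  have hcoord : (fun x : Fin p → K => x i) ∈ coordRing K (Fin p → K) :=
    Algebra.subset_adjoin ⟨i, rfl⟩
  -- Rationality passes through the projection to the torus and then through its coordinate. Both
  -- maps are homomorphic, so the resulting sequence is geometric.
  have h1 := (φ.isRegular_toFun _ hcoord).comp_mem_rationalSeq (z := fun k => π (g ^ k))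
    fun f hf => (E.isRegular_fst f hf).comp_mem_rationalSeq (z := fun k => g ^ k) hg
  apply eq_one_of_pow_mem_rationalSeq
  convert h1 using 2 with k
  simp [subgroupInclusion, π]

variable [IsAlgebraicMonoid K Y]

/-- A torus that maps to the group of invertible elements is conjugate to a subgroup of any given
complement of the unipotent factor. -/
theorem SemidirectDecomposition.exists_conj_mem_T [IsAlgClosed K] [CharZero K]
    (E : SemidirectDecomposition K Y) (hEU : IsUnipotentGroup K E.U) {X : Type*} [AffineVariety K X]
    [Monoid X] {T : Subgroup Xˣ} (hT : IsTorus K T) (hcomm : ∀ t ∈ T, ∀ t' ∈ T, t * t' = t' * t)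
    (α : T →* Yˣ) (hα : ∀ f ∈ coordRing K Y, ∃ f' ∈ coordRing K X, ∀ t : T,
      f (α t : Y) = f' ((t : Xˣ) : X)) :
    ∃ u ∈ E.U, ∀ t, u * α t * u⁻¹ ∈ E.T := by
  -- The target of the conjugation: it takes values in `E.T` and agrees with `α` modulo `E.U`.
  let β : T →* Yˣ := E.T.subtype.comp ((complementProj E.isComplement E.normal_U).comp α)
  have htors : ∀ m : ℕ, m ≠ 0 → ∃ u ∈ E.U, ∀ t : T, t ^ m = 1 → u * α t = β t * u := by
    intro m hm
    let F : Subgroup T :=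
      { carrier := {t | t ^ m = 1}
        one_mem' := one_pow m
        mul_mem' := fun {a b} ha hb => by
          have : Commute a b := Subtype.ext (hcomm a a.2 b b.2)
          show (a * b) ^ m = 1
          rw [this.mul_pow, show a ^ m = 1 from ha, show b ^ m = 1 from hb, one_mul]
        inv_mem' := fun {a} ha => by
          show a⁻¹ ^ m = 1
          rw [inv_pow, show a ^ m = 1 from ha, inv_one] }
    have : Finite F := hT.finite_setOf_pow_eq_one hm
    obtain ⟨u, hu, h⟩ := exists_mul_eq_mul_of_finite E.U E.normal_U E.comm_U
      (fun u hu => hEU.exists_pow_eq hu (Nat.card_pos (α := F)).ne')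
      (fun u hu => hEU.eq_one_of_pow_eq_one hu (Nat.card_pos (α := F)).ne')
      (α.comp F.subtype) (β.comp F.subtype)
      fun t => inv_mul_complementProj_mem E.isComplement E.normal_U _
    exact ⟨u, hu, fun t ht => h ⟨t, ht⟩⟩
  have hmor : ∀ a b : Y, ∀ f ∈ coordRing K Y, (fun y => f (y * a) - f (b * y)) ∈ coordRing K Y :=
    fun a b f hf => sub_mem (isMorphism_mul isMorphism_id (isMorphism_const a) f hf)
      (isMorphism_mul (isMorphism_const b) isMorphism_id f hf)
  have hnoeth : IsNoetherianRing (coordRing K Y) := by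
    have : Algebra.FiniteType K (coordRing K Y) :=
      (coordRing K Y).fg_iff_finiteType.1 fg_functions
    exact Algebra.FiniteType.isNoetherianRing K _
  -- The equations in `y` that express `y * α t = β t * y` for all torsion `t`. Finitely many of
  -- them generate the same ideal, and these involve finitely many `t`, all killed by the product of
  -- their orders. A solution for that exponent therefore solves every equation.
  let s : Set (coordRing K Y) := {r | ∃ t : T, IsOfFinOrder t ∧ ∃ f ∈ coordRing K Y,
    r.1 = fun y => f (y * α t) - f (β t * y)}
  obtain ⟨s', hs's, hspan⟩ := (Submodule.fg_span_iff_fg_span_finset_subset s).1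
    (hnoeth.noetherian (Submodule.span _ s))
  choose! τ hτ F hF hrF using fun r (hr : r ∈ s') => hs's hr
  have hm : ∏ r ∈ s', orderOf (τ r) ≠ 0 :=
    Finset.prod_ne_zero_iff.2 fun r hr => (hτ r hr).orderOf_pos.ne'
  obtain ⟨u, hu, hm'⟩ := htors _ hm
  have hker : Submodule.span _ s ≤ RingHom.ker ((Pi.evalAlgHom K (fun _ : Y => K) (u : Y)).comp
      (coordRing K Y).val) := by
    rw [hspan, Submodule.span_le]
    intro r hr
    show r.1 u = 0
    have h1 := congrArg Units.val (hm' (τ r)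
      (orderOf_dvd_iff_pow_eq_one.1 (Finset.dvd_prod_of_mem _ hr)))
    rw [Units.val_mul, Units.val_mul] at h1
    rw [hrF r hr]
    exact sub_eq_zero.2 (congrArg (F r) h1)
  have hfin : ∀ t : T, IsOfFinOrder t → u * α t = β t * u := by
    intro t ht
    apply Units.ext
    apply point_ext (K := K)
    intro f hf
    have h1 : f (u * α t) - f (β t * u) = 0 :=
      hker (Submodule.subset_span (show (⟨_, hmor (α t) (β t) f hf⟩ : coordRing K Y) ∈ s from
        ⟨t, ht, f, hf, rfl⟩))
    exact sub_eq_zero.1 h1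
  refine ⟨u, hu, fun t => ?_⟩
  obtain ⟨S, hS, hS'⟩ := E.isClosed_T
  refine (hS' _).2 fun f hf => ?_
  -- Density of torsion is applied to the equations of `E.T`, pulled back along `t ↦ u * α t * u⁻¹`,
  -- so regularity of `β` plays no role.
  have hconj : (fun y : Y => f (u * y * (u⁻¹ : Yˣ))) ∈ coordRing K Y :=
    isMorphism_mul (isMorphism_mul (isMorphism_const _) isMorphism_id) (isMorphism_const _)
      f (hS hf)
  obtain ⟨f', hf', hff'⟩ := hα _ hconj
  refine (hff' t).trans (hT.eq_zero_of_forall_isOfFinOrder hf' (fun t ht => ?_) t)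
  rw [← hff' t, ← Units.val_mul, ← Units.val_mul]
  refine (hS' _).1 ?_ f hf
  rw [hfin t ht, mul_inv_cancel_right]
  exact SetLike.coe_mem _

end
/-! ### Isomorphisms of reductions -/

section

variable {K : Type*} [Field K] {X Y : Type*}
  [AffineVariety K X] [IsDomain (coordRing K X)] [Monoid X] [IsAlgebraicMonoid K X]
  [AffineVariety K Y] [IsDomain (coordRing K Y)] [Monoid Y] [IsAlgebraicMonoid K Y]

/-- An isomorphism of monoids that is compatible with the factors is multiplicative for the
reductions. -/
theorem map_reductionMul (ψ : AlgebraicMonoidIso K X Y) {A B : Subgroup Xˣ} {A' B' : Subgroup Yˣ}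
    (hA : ∀ a ∈ A, ∀ a' ∈ A, a * a' = a' * a) (hB : ∀ b ∈ B, ∀ b' ∈ B, b * b' = b' * b)
    (hAB : Subgroup.IsComplement' A B) (hA' : ∀ a ∈ A', ∀ a' ∈ A', a * a' = a' * a)
    (hB' : ∀ b ∈ B', ∀ b' ∈ B', b * b' = b' * b) (hAB' : Subgroup.IsComplement' A' B')
    (hψA : ∀ a ∈ A, Units.map ψ.toMulEquiv.toMonoidHom a ∈ A')
    (hψB : ∀ b ∈ B, Units.map ψ.toMulEquiv.toMonoidHom b ∈ B') (x y : X) :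
    ψ.toMulEquiv (reductionMul K A B hA hB hAB x y) =
      reductionMul K A' B' hA' hB' hAB' (ψ.toMulEquiv x) (ψ.toMulEquiv y) := by
  -- For fixed `y` both sides are morphisms in `x`. Density in `x` alone suffices, since the formula
  -- for `a * b` times `y` holds for every `y`.
  refine congrFun (morphism_eq_of_eqOn_units (K := K)
    (φ := fun x => ψ.toMulEquiv (reductionMul K A B hA hB hAB x y))
    (ψ := fun x => reductionMul K A' B' hA' hB' hAB' (ψ.toMulEquiv x) (ψ.toMulEquiv y))
    (isMorphism_comp ψ.isMorphism_toFun
      (isMorphism_reductionMul_comp isMorphism_id (isMorphism_const y)))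
    (isMorphism_reductionMul_comp ψ.isMorphism_toFun (isMorphism_const _)) fun g => ?_) x
  obtain ⟨a, ha, b, hb, rfl⟩ := exists_mul_decomposition hAB g
  have h1 := reductionMul_left (K := K) (hA := hA') (hB := hB') (hAB := hAB') (hψA a ha) (hψB b hb)
    (ψ.toMulEquiv y)
  rw [← map_mul] at h1
  simp only [reductionMul_left ha hb, map_mul]
  rw [map_mul] at h1
  simpa using h1.symm

end

/-! ### Correction by inner automorphisms -/

section

variable {K : Type*} [Field K] {X Y : Type*} [AffineVariety K X] [Monoid X]
  [AffineVariety K Y] [Monoid Y] [IsAlgebraicMonoid K Y]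

/-- The composite of an isomorphism of monoids with conjugation by an invertible element. -/
def AlgebraicMonoidIso.conj (φ : AlgebraicMonoidIso K X Y) (u : Yˣ) : AlgebraicMonoidIso K X Y where
  toFun x := u * φ.toMulEquiv x * (u⁻¹ : Yˣ)
  invFun y := φ.toMulEquiv.symm ((u⁻¹ : Yˣ) * y * u)
  left_inv x := by simp [mul_assoc]
  right_inv y := by simp [mul_assoc]
  map_mul' x y := by simp [mul_assoc]
  isMorphism_toFun := by
    have h : IsMorphism K (fun x => (u : Y) * φ.toMulEquiv x * (u⁻¹ : Yˣ)) :=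
      isMorphism_mul (isMorphism_mul (isMorphism_const _) φ.isMorphism_toFun) (isMorphism_const _)
    exact h
  isMorphism_invFun := by
    have h : IsMorphism K (fun y : Y => ((u⁻¹ : Yˣ) : Y) * y * u) :=
      isMorphism_mul (isMorphism_mul (isMorphism_const _) isMorphism_id) (isMorphism_const _)
    have h' : IsMorphism K (fun y : Y => φ.toMulEquiv.symm (((u⁻¹ : Yˣ) : Y) * y * u)) :=
      isMorphism_comp φ.isMorphism_invFun h
    exact h'

theorem AlgebraicMonoidIso.units_map_conj (φ : AlgebraicMonoidIso K X Y) (u : Yˣ) (g : Xˣ) :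
    Units.map (φ.conj u).toMulEquiv.toMonoidHom g =
      u * Units.map φ.toMulEquiv.toMonoidHom g * u⁻¹ :=
  Units.ext rfl

end

/-- Let `X` and `Y` be isomorphic irreducible affine algebraic monoids over an algebraically closed
field of characteristic zero, and let `D` and `E` be decompositions of their groups of invertible
elements as semidirect products of a torus and a commutative unipotent group. Then the left
commutative reductions of `X` and `Y` are isomorphic, and so are the right ones. Irreducibility of
`X` is the condition that `K[X]` is a domain. -/
theorem corollary3p7 {K : Type*} [Field K] [IsAlgClosed K] [CharZero K] {X Y : Type*}
    [AffineVariety K X] [IsDomain (coordRing K X)] [Monoid X] [IsAlgebraicMonoid K X]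
    [AffineVariety K Y] [IsDomain (coordRing K Y)] [Monoid Y] [IsAlgebraicMonoid K Y]
    (hXY : Nonempty (AlgebraicMonoidIso K X Y))
    (D : SemidirectDecomposition K X) (hDT : IsTorus K D.T) (hDU : IsUnipotentGroup K D.U)
    (E : SemidirectDecomposition K Y) (hET : IsTorus K E.T) (hEU : IsUnipotentGroup K E.U) :
    Nonempty (AlgebraicMonoidIso K (LeftReduction D) (LeftReduction E)) ∧
      Nonempty (AlgebraicMonoidIso K (RightReduction D) (RightReduction E)) := by
  obtain ⟨φ⟩ := hXY
  obtain ⟨u, -, hT⟩ := E.exists_conj_mem_T hEU hDT D.comm_T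
    ((Units.map φ.toMulEquiv.toMonoidHom).comp D.T.subtype)
    fun f hf => ⟨_, φ.isMorphism_toFun f hf, fun t => rfl⟩
  have hψT : ∀ t ∈ D.T, Units.map (φ.conj u).toMulEquiv.toMonoidHom t ∈ E.T := fun t ht => by
    rw [φ.units_map_conj]
    exact hT ⟨t, ht⟩
  have hψU : ∀ v ∈ D.U, Units.map (φ.conj u).toMulEquiv.toMonoidHom v ∈ E.U := fun v hv =>
    E.mem_U_of_pow_mem_rationalSeq hET fun f hf => by
      simp only [← map_pow]
      exact hDU.pow_mem_rationalSeq hv ((φ.conj u).isMorphism_toFun f hf)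
  -- One map of varieties serves both reductions, with the factors exchanged for the right one.
  -- Inclusions of the factors are enough, since the inverse of a multiplicative bijection is
  -- multiplicative.
  exact ⟨⟨{ (φ.conj u).toMulEquiv.toEquiv with
        map_mul' := map_reductionMul (φ.conj u) D.comm_T D.comm_U D.isComplement E.comm_T E.comm_U
          E.isComplement hψT hψU
        isMorphism_toFun := (φ.conj u).isMorphism_toFun
        isMorphism_invFun := (φ.conj u).isMorphism_invFun }⟩,
    ⟨{ (φ.conj u).toMulEquiv.toEquiv with
        map_mul' := map_reductionMul (φ.conj u) D.comm_U D.comm_T D.isComplement.symm E.comm_U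
          E.comm_T E.isComplement.symm hψU hψT
        isMorphism_toFun := (φ.conj u).isMorphism_toFun
        isMorphism_invFun := (φ.conj u).isMorphism_invFun }⟩⟩
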